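/- **Setting.** Let $\mathbb{N}=\{1,2,\dots\}$, and let $S_{\mathbb{N}}$ be the group of all bijections of $\mathbb{N}$, acting on $\mathbb{Q}[[x_1,x_2,\dots]]$ by $x_i\mapsto x_{v(i)}$. $\tilde\Lambda$ is the set of power series of bounded degree that are fixed, for some $n$, by all $v\in S_{\mathbb{N}}$ with $v(i)=i$ for $i\le n$. $\tilde\Lambda_d$ is its part that is homogeneous of degree $d$, and for a finite multi-set $\mu$ of positive integers $\tilde\Lambda_\mu$ is its part supported on monomials whose multi-set of positive exponents is $\mu$. $e_r$ is the $r$-th elementary symmetric function ($e_0=1$). *Infinite tableaux.* An infinite Ferrers diagram $\hat\lambda$ is a Ferrers diagram with infinite first row and finitely many boxes below it (the finite part). A standard tableau $\hat T\in\mathrm{SYT}(\hat\lambda)$ is a filling of $\hat\lambda$ by the elements of $\mathbb{N}$, each once, increasing along rows and columns. An element $\hat M\in\mathrm{SSYT}(\hat\lambda)$ is a semi-standard filling of the finite part by positive integers (rows weakly, columns strictly increasing), together with multiplicities $m_h\ge0$ ($h>0$), almost all $0$; its first row is thought of as infinitely many zeros followed by each $h$ taken $m_h$ times. Its content $\mu$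 is the multi-set of entries of the finite part together with each $h$ taken $m_h$ times; $\Sigma(\hat M)$ is the sum of $\mu$; $\mathrm{Dsp}^c(\hat M)$ is the multi-set of the numbers $|\{a\in\mu: a\ge h\}|$ for $1\le h\le\max\mu$. $\hat C\in\mathrm{SSYT}(\hat\lambda)$ is a cocharge tableau ($\hat C\in\mathrm{CCT}(\hat\lambda)$) if every $h$ with $m_h>0$ appears in the finite part, and for each $h>1$ in the finite part, either $m_{h-1}>0$ or the leftmost instance of $h$ lies in a row below an instance of $h-1$ in the finite part. Then $\mathrm{Dsp}^c(\hat C)$ is a set. *Groups.* $R(\hat T)$ and $C(\hat T)$ are the groups of permutations preserving each row, respectively each column, of $\hat T$; $\tilde C(\hat T)$ is the group of permutations mapping every column onto a column. $\widetilde{\mathrm{sgn}}$ is the character of $\tilde C(\hat T)$ that is the sign on the (finite) group $C(\hat T)$ and is trivial on $R(\hat T)\cap\tilde C(\hat T)$. *Polynomials.* $p_{\hat M,\hat T}=\prod_i x_i^{h_i}$, where $h_i$ is the entry of $\hat M$ in the box of $i$ in $\hat T$ if this box is in the finite part, and on the first row of $\hat T$ the value $h>0$ is assigned to $m_h$ arbitrarily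 chosen $i$'s (disjointly for different $h$) and $0$ to the others. $F_{\hat M,\hat T}=\sum_{\sigma\in C(\hat T)}\mathrm{sgn}(\sigma)\,\sigma\big(\sum q\big)$, where $q$ runs over the distinct monomials in the $R(\hat T)$-orbit of $p_{\hat M,\hat T}$; it does not depend on the choices. $V_{\hat M}$ is the span of $F_{\hat M,\hat T}$ over $\hat T\in\mathrm{SYT}(\hat\lambda)$. For $\hat C\in\mathrm{CCT}(\hat\lambda)$ and a finite multi-set $I$ of non-negative integers containing $\mathrm{Dsp}^c(\hat C)$, put $F^{I,\mathrm{hom}}_{\hat C,\hat T}=F_{\hat C,\hat T}\prod_{i\in I\setminus\mathrm{Dsp}^c(\hat C)}e_i$. If $I$ is a finite set of positive integers containing $\mathrm{Dsp}^c(\hat C)$, put $F^{I}_{\hat C,\hat T}=F_{\hat C,\hat T}\prod_{i\in I\setminus\mathrm{Dsp}^c(\hat C)}e_{r_i}$ with $r_i=|\{1\le j<i: j\notin I\}|$, and $D_I=\Sigma(\hat C)+\sum_{i\in I\setminus\mathrm{Dsp}^c(\hat C)}r_i$. For $\vec h=(h_r)_{r\ge1}$ with finitely many non-zero entries, $V_{\hat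 C}^{\vec h}=V_{\hat C}\cdot\prod_r e_r^{h_r}$. *Finite objects.* For a partition $\lambda\vdash n$, $T\in\mathrm{SYT}(\lambda)$, and $M\in\mathrm{SSYT}(\lambda)$ (entries $\geq0$), the polynomials $F_{M,T}$, $F^{I,\mathrm{hom}}_{M,T}$ ($I$ a multi-set in $\{0,\dots,n\}$) and $F^{I}_{M,T}$ ($I\subseteq\{1,\dots,n-1\}$) in $\mathbb{Q}[x_1,\dots,x_n]$ are defined in the same way, from the monomial $\prod_{i\le n}x_i^{h_i}$ with $h_i$ the entry of $M$ in the box of $i$ in $T$, and with elementary symmetric polynomials in $x_1,\dots,x_n$. We say that $(\lambda,T,M)$ produces $(\hat\lambda,\hat T,\hat M)$ if $\hat T$ is obtained from $T$ by appending $n+1,n+2,\dots$ to the first row, and $\hat M$ has the same rows as $M$ below the first one, with $m_h$ the number of occurrences of $h>0$ in the first row of $M$ (i.e. $\hat M$ is the limit of repeatedly pushing the first row of $M$ to the right and inserting $0$). **Proposition.** Let $\hat\lambda$ be an infinite Ferrers diagram, $\hat T\in\mathrm{SYT}(\hat\lambda)$, $\hat M\in\mathrm{SSYT}(\hat\lambda)$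 with content $\mu$ and $d=\Sigma(\hat M)$. 1. $\sigma F_{\hat M,\hat T}=\widetilde{\mathrm{sgn}}(\sigma)F_{\hat M,\hat T}$ for all $\sigma\in\tilde C(\hat T)$. 2. $F_{\hat M,\hat T}\in\tilde\Lambda_\mu$ and $F_{\hat M,\hat T}\in\tilde\Lambda_d$, and $V_{\hat M}\subseteq\tilde\Lambda_\mu\subseteq\tilde\Lambda_d\subseteq\tilde\Lambda$. 3. If $\hat M=\hat C$ is a cocharge tableau, then for all $I$ (a finite set of positive integers, respectively a finite multi-set of non-negative integers) containing $\mathrm{Dsp}^c(\hat C)$ and all $\vec h$ as above, $F^I_{\hat C,\hat T}\in\tilde\Lambda_{D_I}$, $F^{I,\mathrm{hom}}_{\hat C,\hat T}\in\tilde\Lambda_{\sum_{i\in I}i}$, and $V^{\vec h}_{\hat C}\subseteq\tilde\Lambda_{d+\sum_r r h_r}$. 4. Let $(\lambda,T,M)$, $\lambda\vdash n$, produce $(\hat\lambda,\hat T,\hat M)$. Substituting $x_m=0$ for all $m>n$ in $F_{\hat M,\hat T}$ gives $F_{M,T}$. If every box in the first row of $M$ that lies over another box contains $0$, then $F_{\hat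 M,\hat T}$ is the only element of $\tilde\Lambda_\mu$ that transforms under $\tilde C(\hat T)$ by $\widetilde{\mathrm{sgn}}$ and gives $F_{M,T}$ under this substitution. If $n\ge d+\lambda_2$, it is the only such element among all homogeneous elements of $\tilde\Lambda$. 5. Let $(\lambda,T,C)$, $\lambda\vdash n$, produce $(\hat\lambda,\hat T,\hat C)$ with $\hat C\in\mathrm{CCT}(\hat\lambda)$. Let $I$ be a multi-set in $\{0,\dots,n\}$ containing $\mathrm{Dsp}^c(\hat C)$. Then $F^{I,\mathrm{hom}}_{\hat C,\hat T}$ transforms under $\tilde C(\hat T)$ by $\widetilde{\mathrm{sgn}}$ and gives $F^{I,\mathrm{hom}}_{C,T}$ under $x_m=0$ for $m>n$; if $n\ge\lambda_2+\sum_{i\in I}i$, it is the only homogeneous element of $\tilde\Lambda$ with these two properties. If $I\subseteq\{1,\dots,n-1\}$ is a set containing $\mathrm{Dsp}^c(\hat C)$, the same holds for $F^{I}_{\hat C,\hat T}$ and $F^I_{C,T}$, with uniqueness among the homogeneous elements of $\tilde\Lambda$ if $n\ge\lambda_2+D_I$. -/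

import Mathlib

open scoped Classical in
/-- The sign of a permutation of `ℕ` of finite support, computed on its support
(junk value `1` if the support is infinite). -/
noncomputable def finitarySign (σ : Equiv.Perm ℕ) : ℤˣ :=
  if h : {i | σ i ≠ i}.Finite then
    haveI : Fintype {i // σ i ≠ i} := h.fintype
    Equiv.Perm.sign (σ.subtypePerm (p := fun i => σ i ≠ i) (fun _ => by simp))
  else 1

/-! ### Diagrams and tableaux

Boxes are pairs `(row, column)`, both counted from `0` as in `YoungDiagram`; row `0` is the first
row. The variables `x₁, x₂, …` and the entries `1, 2, …` of standard tableaux are likewise indexed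
from `0`: the index `i` stands for `i + 1`, `Fin n` for `{1, …, n}`, and `ℕ` for `{1, 2, …}`. -/

/-- An infinite Ferrers diagram: the first row is infinite and only finitely many boxes
lie below it. -/
structure InfiniteFerrers where
  cells : Set (ℕ × ℕ)
  isLowerSet : IsLowerSet cells
  first_row : ∀ j, (0, j) ∈ cells
  finite_below : {c | c ∈ cells ∧ c.1 ≠ 0}.Finite

/-- The finite part: the complement of the first row. -/
noncomputable def InfiniteFerrers.finitePart (L : InfiniteFerrers) : Finset (ℕ × ℕ) :=
  L.finite_below.toFinset

/-- A standard tableau of shape `D` whose entries are the elements of `ι`, each once, encoded by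
the box `box i` containing the entry `i`. Entries increase along rows and columns. Used with
`ι = Fin n` and `D` a Young diagram, and with `ι = ℕ` and `D` an infinite Ferrers diagram. -/
structure StdTableau (ι : Type) [LinearOrder ι] (D : Set (ℕ × ℕ)) where
  box : ι → ℕ × ℕ
  bijOn : Set.BijOn box Set.univ D
  row_strict : ∀ a b, (box a).1 = (box b).1 → (box a).2 < (box b).2 → a < b
  col_strict : ∀ a b, (box a).2 = (box b).2 → (box a).1 < (box b).1 → a < b

namespace StdTableau

variable {ι : Type} [LinearOrder ι] {D : Set (ℕ × ℕ)} (T : StdTableau ι D)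

/-- `R(T)`: the permutations preserving every row. -/
def rowGroup : Subgroup (Equiv.Perm ι) where
  carrier := {σ | ∀ i, (T.box (σ i)).1 = (T.box i).1}
  mul_mem' := fun {a b} ha hb i => (ha (b i)).trans (hb i)
  one_mem' := fun _ => rfl
  inv_mem' := fun {a} ha i => by simpa using (ha (a⁻¹ i)).symm

/-- `C(T)`: the permutations preserving every column. -/
def colGroup : Subgroup (Equiv.Perm ι) where
  carrier := {σ | ∀ i, (T.box (σ i)).2 = (T.box i).2}
  mul_mem' := fun {a b} ha hb i => (ha (b i)).trans (hb i)
  one_mem' := fun _ => rfl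
  inv_mem' := fun {a} ha i => by simpa using (ha (a⁻¹ i)).symm

/-- `C̃(T)`: the permutations that map every column onto a (possibly different) column, which
is then of the same length. -/
def colTildeGroup : Subgroup (Equiv.Perm ι) where
  carrier := {σ | ∀ i j, (T.box (σ i)).2 = (T.box (σ j)).2 ↔ (T.box i).2 = (T.box j).2}
  mul_mem' := fun {a b} ha hb i j => (ha (b i) (b j)).trans (hb i j)
  one_mem' := fun _ _ => Iff.rfl
  inv_mem' := fun {a} ha i j => by simpa using (ha (a⁻¹ i) (a⁻¹ j)).symm

end StdTableau

open scoped Classical in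
/-- The character of `C̃(T)` that is the sign on `C(T)` and trivial on `R(T) ∩ C̃(T)`: the value
at `σ = c * r` is the sign of `c`. -/
noncomputable def sgnTilde {D : Set (ℕ × ℕ)} (T : StdTableau ℕ D) (σ : Equiv.Perm ℕ) : ℤˣ :=
  if h : ∃ c ∈ T.colGroup, ∃ r ∈ T.rowGroup ⊓ T.colTildeGroup, σ = c * r then
    finitarySign h.choose
  else 1

/-- The decomposition used in `sgnTilde` is unique. -/
theorem sgnTilde_mul {D : Set (ℕ × ℕ)} (T : StdTableau ℕ D) {c r : Equiv.Perm ℕ}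
    (hc : c ∈ T.colGroup) (hr : r ∈ T.rowGroup ⊓ T.colTildeGroup) :
    sgnTilde T (c * r) = finitarySign c := by
  have h : ∃ c' ∈ T.colGroup, ∃ r' ∈ T.rowGroup ⊓ T.colTildeGroup, c * r = c' * r' :=
    ⟨c, hc, r, hr, rfl⟩
  have key : h.choose = c := by
    obtain ⟨hc', r', hr', he⟩ := h.choose_spec
    generalize h.choose = c' at hc' he
    have e1 : c'⁻¹ * c = r' * r⁻¹ := by
      rw [eq_mul_inv_iff_mul_eq, mul_assoc, he, inv_mul_cancel_left]
    have m1 : c'⁻¹ * c ∈ T.colGroup := mul_mem (inv_mem hc') hc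
    have m2 : c'⁻¹ * c ∈ T.rowGroup := e1 ▸ mul_mem hr'.1 (inv_mem hr.1)
    have e2 : c'⁻¹ * c = 1 := by
      ext1 i
      exact T.bijOn.injOn (Set.mem_univ _) (Set.mem_univ _) (Prod.ext (m2 i) (m1 i))
    exact (inv_mul_eq_one.mp e2)
  rw [sgnTilde, dif_pos h, key]

/-- An infinite semi-standard Young tableau: a semi-standard filling of the finite part by positive
integers, and a finitely supported multiplicity for every `h > 0`. The displayed first row
consists of zeros. -/
structure InfiniteSSYT (L : InfiniteFerrers) where
  entry : ℕ → ℕ → ℕ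
  mult : ℕ →₀ ℕ
  pos : ∀ {i j}, i ≠ 0 → (i, j) ∈ L.cells → 0 < entry i j
  row_weak : ∀ {i j₁ j₂}, j₁ < j₂ → (i, j₂) ∈ L.cells → entry i j₁ ≤ entry i j₂
  col_strict : ∀ {i₁ i₂ j}, i₁ < i₂ → (i₂, j) ∈ L.cells → entry i₁ j < entry i₂ j
  first_row : ∀ j, entry 0 j = 0
  zeros : ∀ {i j}, (i, j) ∉ L.cells → entry i j = 0
  mult_zero : mult 0 = 0

namespace InfiniteSSYT

variable {L : InfiniteFerrers} (M : InfiniteSSYT L)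

/-- The content: the multi-set of all positive entries, including the multiplicities. -/
noncomputable def content : Multiset ℕ :=
  L.finitePart.val.map (fun c => M.entry c.1 c.2) + Finsupp.toMultiset M.mult

/-- Infinite cocharge tableaux. Every `h` with positive multiplicity appears in the finite part,
and if `h` appears in the finite part, then its leftmost instance lies below an instance of
`h - 1`, where the instances in the first row are given by the multiplicities (and by
the infinitely many zeros in case `h = 1`, where there is hence no condition). -/
def IsCocharge : Prop :=
  (∀ h, 0 < M.mult h → ∃ c ∈ L.finitePart, M.entry c.1 c.2 = h) ∧
  ∀ h, 1 < h → ∀ c ∈ L.finitePart, M.entry c.1 c.2 = h →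
    (∀ c' ∈ L.finitePart, M.entry c'.1 c'.2 = h → c.2 ≤ c'.2) →
    0 < M.mult (h - 1) ∨ ∃ c' ∈ L.finitePart, c'.1 < c.1 ∧ M.entry c'.1 c'.2 = h - 1

end InfiniteSSYT

/-- The content, zeros included, of a finite semi-standard tableau. -/
def SemistandardYoungTableau.content {lam : YoungDiagram} (M : SemistandardYoungTableau lam) :
    Multiset ℕ :=
  lam.cells.val.map (fun c => M c.1 c.2)

/-- `Dspᶜ`, as a function of the content: for every `h` between `1` and the maximal entry, take
the number of entries that are at least `h`. -/
def dspc (μ : Multiset ℕ) : Multiset ℕ :=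
  (Finset.Icc 1 μ.sup).val.map (fun h => Multiset.card (μ.filter (fun a => h ≤ a)))

/-! ### How finite tableaux produce infinite ones -/

/-- `T̂` is the limit of `T, ιT, ι²T, …`, where `ι` adds a box at the end of the first row and
fills it with the next integer. -/
def TableauProduces {n : ℕ} {lam : YoungDiagram} {L : InfiniteFerrers}
    (T : StdTableau (Fin n) (lam : Set (ℕ × ℕ))) (That : StdTableau ℕ L.cells) : Prop :=
  (∀ i : Fin n, That.box i = T.box i) ∧ ∀ k, That.box (n + k) = (0, lam.rowLen 0 + k)

/-- `M̂` is the limit of `M, ι̂M, ι̂²M, …`, where `ι̂` pushes the first row one box to the right and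
puts `0` in the new box: the rows below the first one agree, and the multiplicity of each `h > 0`
is the number of its occurrences in the first row of `M`. -/
def SSYTProduces {lam : YoungDiagram} {L : InfiniteFerrers}
    (M : SemistandardYoungTableau lam) (Mhat : InfiniteSSYT L) : Prop :=
  (∀ i j, i ≠ 0 → ((i, j) ∈ lam ↔ (i, j) ∈ L.cells)) ∧
  (∀ i j, i ≠ 0 → M i j = Mhat.entry i j) ∧
  ∀ h, 0 < h → Mhat.mult h = ((Finset.range (lam.rowLen 0)).filter (fun j => M 0 j = h)).card

/-! ### Eventually symmetric functions -/

/-- The bijection `v` of the index set acts by `x_i ↦ x_{v i}`. -/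
noncomputable def permAct {ι : Type} (v : Equiv.Perm ι) (F : MvPowerSeries ι ℚ) :
    MvPowerSeries ι ℚ :=
  MvPowerSeries.renameEquiv ℚ v F

/-- `F` is homogeneous of degree `d`. -/
def IsHomogeneousSeries (d : ℕ) (F : MvPowerSeries ℕ ℚ) : Prop :=
  ∀ m, MvPowerSeries.coeff m F ≠ 0 → m.degree = d

/-- The ring `Λ̃` of eventually symmetric functions: series of bounded degree fixed by all the
permutations that fix each of the first `n` indices, for some `n`. -/
def evSym : Set (MvPowerSeries ℕ ℚ) :=
  {F | (∃ d, ∀ m, MvPowerSeries.coeff m F ≠ 0 → m.degree ≤ d) ∧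
    ∃ n, ∀ v : Equiv.Perm ℕ, (∀ i < n, v i = i) → permAct v F = F}

/-- `Λ̃_d`. -/
def evSymDeg (d : ℕ) : Set (MvPowerSeries ℕ ℚ) :=
  {F | F ∈ evSym ∧ IsHomogeneousSeries d F}

/-- The content of a monomial: the multi-set of its positive exponents. -/
def monomialContent (m : ℕ →₀ ℕ) : Multiset ℕ := m.support.val.map m

/-- `Λ̃_μ`: the elements of `Λ̃` supported on monomials of content `μ`. -/
def evSymContent (μ : Multiset ℕ) : Set (MvPowerSeries ℕ ℚ) :=
  {F | F ∈ evSym ∧ ∀ m, MvPowerSeries.coeff m F ≠ 0 → monomialContent m = μ}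

/-- The substitution `x_m = 0` for all `m > n`. -/
noncomputable def restrictVars (n : ℕ) (F : MvPowerSeries ℕ ℚ) : MvPowerSeries (Fin n) ℚ :=
  MvPowerSeries.killCompl (Fin.valEmbedding : Fin n ↪ ℕ) F

open scoped Classical in
/-- The elementary symmetric function `e_r` in infinitely many variables. -/
noncomputable def elemSymm (r : ℕ) : MvPowerSeries ℕ ℚ :=
  fun m => if (∀ i, m i ≤ 1) ∧ m.support.card = r then 1 else 0

/-! ### Generalized higher Specht polynomials -/

section Finite

variable {n : ℕ} {lam : YoungDiagram} (M : SemistandardYoungTableau lam)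
  (T : StdTableau (Fin n) (lam : Set (ℕ × ℕ)))

/-- The exponent of `p_{M,T}`: the variable `x_i` gets the entry of `M` in the box of `i`. -/
noncomputable def finiteExponent : Fin n →₀ ℕ :=
  Finsupp.equivFunOnFinite.symm (fun i => M (T.box i).1 (T.box i).2)

open scoped Classical in
/-- `F_{M,T}`: the image of the sum over the `R(T)`-orbit of `p_{M,T}` under the
signed sum over `C(T)`. -/
noncomputable def spechtPoly : MvPolynomial (Fin n) ℚ :=
  ∑ σ ∈ Finset.univ.filter (fun σ : Equiv.Perm (Fin n) => σ ∈ T.colGroup),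
    ((Equiv.Perm.sign σ : ℤ) : ℚ) • MvPolynomial.rename σ
      (∑ q ∈ (Finset.univ.filter (fun τ : Equiv.Perm (Fin n) => τ ∈ T.rowGroup)).image
          (fun τ => (finiteExponent M T).equivMapDomain τ),
        MvPolynomial.monomial q (1 : ℚ))

/-- `F^{I,hom}_{M,T}` for a multi-set `I` containing `Dspᶜ(M)`. -/
noncomputable def spechtPolyHom (I : Multiset ℕ) : MvPolynomial (Fin n) ℚ :=
  spechtPoly M T * ((I - dspc M.content).map (fun i => MvPolynomial.esymm (Fin n) ℚ i)).prod

/-- The numbers `r_i` for `i` in a subset `I` of `{1, …, n - 1}`. -/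
def finiteR (n : ℕ) (I : Finset ℕ) (i : ℕ) : ℕ :=
  ((Finset.Ico 1 n \ I).filter (fun j => j < i)).card

/-- `F^I_{M,T}` for a subset `I` of `{1, …, n - 1}` containing `Dspᶜ(M)`. -/
noncomputable def spechtPolySet (I : Finset ℕ) : MvPolynomial (Fin n) ℚ :=
  spechtPoly M T *
    ((I.val - dspc M.content).map (fun i => MvPolynomial.esymm (Fin n) ℚ (finiteR n I i))).prod

end Finite

section Infinite

variable {L : InfiniteFerrers} (M : InfiniteSSYT L) (T : StdTableau ℕ L.cells)

/-- `p` is an admissible choice of the exponent of `p_{M̂,T̂}`: on the finite part it is given by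
the entries of `M̂`, and on the first row of `T̂` each `h > 0` is taken as many times as its
multiplicity prescribes. -/
def IsStableExponent (p : ℕ →₀ ℕ) : Prop :=
  (∀ i, (T.box i).1 ≠ 0 → p i = M.entry (T.box i).1 (T.box i).2) ∧
  ∀ h, 0 < h → {i | (T.box i).1 = 0 ∧ p i = h}.ncard = M.mult h

theorem ncard_getD_eq_count {h : ℕ} (hh : 0 < h) (l : List ℕ) :
    {j : ℕ | l.getD j 0 = h}.Finite ∧ {j : ℕ | l.getD j 0 = h}.ncard = l.count h := by
  induction l with
  | nil =>
    have : {j : ℕ | ([] : List ℕ).getD j 0 = h} = ∅ := by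
      ext j; simp; omega
    rw [this]; simp
  | cons a l ih =>
    have e : {j : ℕ | (a :: l).getD j 0 = h} =
        {j : ℕ | j = 0 ∧ a = h} ∪ Nat.succ '' {j : ℕ | l.getD j 0 = h} := by
      ext j
      cases j <;> simp
    have hf : (Nat.succ '' {j : ℕ | l.getD j 0 = h}).Finite := ih.1.image _
    by_cases ha : a = h
    · have e2 : {j : ℕ | j = 0 ∧ a = h} = {0} := by ext j; simp [ha]
      rw [e, e2]
      refine ⟨(Set.finite_singleton _).union hf, ?_⟩
      rw [Set.singleton_union, Set.ncard_insert_of_notMem (by simp) hf,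
        Set.ncard_image_of_injective _ Nat.succ_injective, ih.2, ha, List.count_cons_self]
    · have e2 : {j : ℕ | j = 0 ∧ a = h} = ∅ := by ext j; simp [ha]
      rw [e, e2, Set.empty_union]
      exact ⟨hf, by rw [Set.ncard_image_of_injective _ Nat.succ_injective, ih.2,
        List.count_cons_of_ne ha]⟩

theorem exists_isStableExponent : ∃ p : ℕ →₀ ℕ, IsStableExponent M T p := by
  classical
  set l : List ℕ := (Finsupp.toMultiset M.mult).toList with hl
  set f : ℕ → ℕ := fun i =>
    if (T.box i).1 = 0 then l.getD (T.box i).2 0 else M.entry (T.box i).1 (T.box i).2 with hf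
  have inj : Function.Injective T.box := fun a b h =>
    T.bijOn.injOn (Set.mem_univ _) (Set.mem_univ _) h
  have fin : (Function.support f).Finite := by
    have : (((L.finitePart ∪ ({0} ×ˢ Finset.range l.length) : Finset (ℕ × ℕ)) :
        Set (ℕ × ℕ))).Finite := Finset.finite_toSet _
    refine (this.preimage (f := T.box) inj.injOn).subset ?_
    intro i hi
    have hmem : T.box i ∈ L.cells := T.bijOn.mapsTo (Set.mem_univ i)
    by_cases h0 : (T.box i).1 = 0
    · have h1 : l.getD (T.box i).2 0 ≠ 0 := by simpa [hf, h0] using hi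
      have h2 : (T.box i).2 < l.length := by
        by_contra hc
        exact h1 (List.getD_eq_default _ _ (not_lt.mp hc))
      have h3 : T.box i = (0, (T.box i).2) := Prod.ext h0 rfl
      have h4 : T.box i ∈ ({0} ×ˢ Finset.range l.length : Finset (ℕ × ℕ)) := by
        rw [h3]; simp [h2]
      exact Finset.mem_coe.mpr (Finset.mem_union_right _ h4)
    · simp [InfiniteFerrers.finitePart, h0, hmem]
  refine ⟨Finsupp.ofSupportFinite f fin, ?_, ?_⟩
  · intro i hi
    simp [Finsupp.ofSupportFinite_coe, hf, hi]
  · intro h hh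
    have e : (fun i => (T.box i).2) '' {i | (T.box i).1 = 0 ∧ Finsupp.ofSupportFinite f fin i = h}
        = {j : ℕ | l.getD j 0 = h} := by
      ext j
      simp only [Finsupp.ofSupportFinite_coe, Set.mem_image, Set.mem_ofPred_eq]
      constructor
      · rintro ⟨i, ⟨h0, h1⟩, rfl⟩
        simpa [hf, h0] using h1
      · intro hj
        obtain ⟨i, -, hi⟩ := T.bijOn.surjOn (L.first_row j)
        exact ⟨i, ⟨by rw [hi], by simpa [hf, hi] using hj⟩, by rw [hi]⟩
    rw [← Set.InjOn.ncard_image (f := fun i => (T.box i).2), e, (ncard_getD_eq_count hh l).2,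
      ← Multiset.coe_count, hl, Multiset.coe_toList, Finsupp.count_toMultiset]
    intro a ha b hb hab
    exact inj (Prod.ext (ha.1.trans hb.1.symm) hab)

/-- The exponent of the monomial `p_{M̂,T̂}`, for some choice of variables in the first row. -/
noncomputable def stableExponent : ℕ →₀ ℕ := (exists_isStableExponent M T).choose

open scoped Classical in
/-- The sum of all the monomials in the orbit of `x^p` under the group `R`, each taken once. -/
noncomputable def orbitSeries (R : Subgroup (Equiv.Perm ℕ)) (p : ℕ →₀ ℕ) : MvPowerSeries ℕ ℚ :=
  fun m => if ∃ τ ∈ R, m = p.equivMapDomain τ then 1 else 0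

/-- The stable generalized higher Specht polynomial `F_{M̂,T̂}`: the image of the sum over the
`R(T̂)`-orbit of `p_{M̂,T̂}` under the signed sum over the (finite) group `C(T̂)`. -/
noncomputable def stableSpecht : MvPowerSeries ℕ ℚ :=
  ∑ᶠ (σ : Equiv.Perm ℕ) (_ : σ ∈ T.colGroup),
    ((finitarySign σ : ℤ) : ℚ) • permAct σ (orbitSeries T.rowGroup (stableExponent M T))

/-- `F^{I,hom}_{Ĉ,T̂}` for a multi-set `I` containing `Dspᶜ(Ĉ)`. -/
noncomputable def stableSpechtHom (I : Multiset ℕ) : MvPowerSeries ℕ ℚ :=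
  stableSpecht M T * ((I - dspc M.content).map elemSymm).prod

/-- The numbers `r_i` for `i` in a finite set `I` of positive integers. -/
def stableR (I : Finset ℕ) (i : ℕ) : ℕ := ((Finset.Ico 1 i).filter (fun j => j ∉ I)).card

/-- `F^I_{Ĉ,T̂}` for a finite set `I` of positive integers containing `Dspᶜ(Ĉ)`. -/
noncomputable def stableSpechtSet (I : Finset ℕ) : MvPowerSeries ℕ ℚ :=
  stableSpecht M T * ((I.val - dspc M.content).map (fun i => elemSymm (stableR I i))).prod

/-- The degree of `F^I_{Ĉ,T̂}`. -/
noncomputable def stableSetDegree (I : Finset ℕ) : ℕ :=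
  M.content.sum + ((I.val - dspc M.content).map (stableR I)).sum

/-- `V_{M̂}`: the span of all the `F_{M̂,T̂}`. -/
noncomputable def stableSpechtSpace : Submodule ℚ (MvPowerSeries ℕ ℚ) :=
  Submodule.span ℚ (Set.range (fun T : StdTableau ℕ L.cells => stableSpecht M T))

/-- `V_{Ĉ}^h`: the products of the elements of `V_{Ĉ}` with `∏ e_r ^ h_r`. -/
noncomputable def stableSpechtSpaceMul (h : ℕ →₀ ℕ) : Set (MvPowerSeries ℕ ℚ) :=
  {G | ∃ F ∈ stableSpechtSpace M, G = F * h.prod (fun r k => elemSymm r ^ k)}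

/-- `C̃(T̂)` acts on `G` through its character. -/
def TransformsBySgnTilde (G : MvPowerSeries ℕ ℚ) : Prop :=
  ∀ σ ∈ T.colTildeGroup, permAct σ G = ((sgnTilde T σ : ℤ) : ℚ) • G

end Infinite

/-! ### Permutations of finite support -/

/-! Equivariance rests on the factorization of `colTildeGroup` as `colGroup` times `rowGroup ⊓
colTildeGroup` (`exists_eq_mul_of_mem_colTildeGroup`). Left translation by a column permutation
reindexes the signed sum and produces its sign. Conjugation by an element r of the second factor
permutes the column group without changing signs, and r fixes the row-orbit sum.

All but finitely many entries are alone in their column, and permuting those entries stays in the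
second factor. Hence the series is eventually symmetric. Its content is read off from one exponent,
because permutations preserve content.

The restriction to n variables is compared coefficient by coefficient. Column permutations move only
indices below n, so the two column groups match with equal signs. Lying in a given row orbit depends
only on how often each non-zero exponent occurs in each row (`exists_rowPreserving_iff`), and these
counts agree on both sides.

For uniqueness, let D be the difference of two candidates. Two equal exponents in one column force
the coefficient in D to vanish, so at most one exponent per column is zero. If every monomial of D
has at most n - λ₂ variables and one of them involves an index ≥ n, then some index below n in a
column beyond λ₂ is unused. Exchanging the two leaves D invariant and lowers the number of indices ≥
n, until the restriction, which is zero, applies (`eq_zero_of_restrictVars_eq_zero`). The bound on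
the number of variables comes from the content or from the degree. In the second case the degree of
a competitor is forced by a non-zero restriction, and non-vanishing follows from a triangularity
argument (`eq_one_of_rows_rearranged`). -/

/-- Signs agree along a bijection of the moved points alone, so the ambient type is irrelevant. This
reduces facts about `finitarySign` to the sign on a finite type. -/
theorem finitarySign_extendDomain {α : Type} [Fintype α] [DecidableEq α] {p : ℕ → Prop}
    [DecidablePred p] (f : α ≃ Subtype p) (σ : Equiv.Perm α) :
    finitarySign (σ.extendDomain f) = Equiv.Perm.sign σ := by
  classical
  have key : ∀ i, σ.extendDomain f i ≠ i → p i := fun i hi => by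
    by_contra h
    exact hi (Equiv.Perm.extendDomain_apply_not_subtype _ _ h)
  have fin : {i | σ.extendDomain f i ≠ i}.Finite := by
    refine (Set.finite_range (fun a => (f a : ℕ))).subset fun i hi => ?_
    exact ⟨f.symm ⟨i, key i hi⟩, by simp⟩
  rw [finitarySign, dif_pos fin]
  let : Fintype {i // σ.extendDomain f i ≠ i} := fin.fintype
  refine Eq.trans ?_ (Equiv.Perm.sign_bij (f := (σ.extendDomain f).subtypePerm
    (p := fun i => σ.extendDomain f i ≠ i) (fun _ => by simp)) (g := σ)
    (fun x _ => f.symm ⟨x.1, key x.1 x.2⟩) ?_ ?_ ?_)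
  · congr!
  · rintro ⟨x, hx⟩ h1 h2
    rw [Equiv.symm_apply_eq]
    apply Subtype.ext
    simp [Equiv.Perm.extendDomain_apply_subtype σ f (key x hx)]
  · rintro ⟨x, hx⟩ ⟨y, hy⟩ h1 h2 h
    simpa using h
  · intro y hy
    have h : σ.extendDomain f (f y) ≠ f y := by
      rw [Equiv.Perm.extendDomain_apply_image]
      exact fun h => hy (f.injective (Subtype.ext h))
    have h2 : σ.extendDomain f (σ.extendDomain f (f y)) ≠ σ.extendDomain f (f y) :=
      fun h' => h ((σ.extendDomain f).injective h')
    exact ⟨⟨f y, h⟩, fun h' => h (congrArg Subtype.val h'), by simp⟩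

theorem exists_eq_extendDomain {N : ℕ} {σ : Equiv.Perm ℕ} (h : ∀ i, N ≤ i → σ i = i) :
    ∃ τ : Equiv.Perm (Fin N), σ = τ.extendDomain Fin.equivSubtype := by
  have hlt : ∀ i, σ i < N ↔ i < N := fun i => by
    constructor
    · intro hi
      by_contra hc
      rw [h i (not_lt.mp hc)] at hi
      exact hc hi
    · intro hi
      by_contra hc
      have := σ.injective (h _ (not_lt.mp hc))
      omega
  refine ⟨Fin.equivSubtype.symm.permCongr (σ.subtypePerm hlt), ?_⟩
  ext i
  by_cases hi : i < N
  · rw [Equiv.Perm.extendDomain_apply_subtype (p := fun j => j < N) _ _ hi]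
    simp [Equiv.permCongr_apply]
  · rw [Equiv.Perm.extendDomain_apply_not_subtype (p := fun j => j < N) _ _ hi, h i (not_lt.mp hi)]

/-- The bound N excludes infinite supports, where the junk value 1 would break multiplicativity;
below it both factors live in `Equiv.Perm (Fin N)`. -/
theorem finitarySign_mul {N : ℕ} {σ τ : Equiv.Perm ℕ} (hσ : ∀ i, N ≤ i → σ i = i)
    (hτ : ∀ i, N ≤ i → τ i = i) :
    finitarySign (σ * τ) = finitarySign σ * finitarySign τ := by
  obtain ⟨s, rfl⟩ := exists_eq_extendDomain hσ
  obtain ⟨t, rfl⟩ := exists_eq_extendDomain hτ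
  rw [Equiv.Perm.extendDomain_mul, finitarySign_extendDomain, finitarySign_extendDomain,
    finitarySign_extendDomain, Equiv.Perm.sign_mul]

theorem finitarySign_one : finitarySign 1 = 1 := by
  have h := finitarySign_extendDomain (Fin.equivSubtype (n := 0)) 1
  rwa [Equiv.Perm.extendDomain_one, Equiv.Perm.sign_one] at h

theorem finitarySign_swap {a b : ℕ} (h : a ≠ b) : finitarySign (Equiv.swap a b) = -1 := by
  obtain ⟨s, hs⟩ := exists_eq_extendDomain (N := a + b + 1) (σ := Equiv.swap a b)
    (fun i hi => Equiv.swap_apply_of_ne_of_ne (by omega) (by omega))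
  have e : s = Equiv.swap ⟨a, by omega⟩ ⟨b, by omega⟩ := by
    ext i
    have h1 := DFunLike.congr_fun hs (i : ℕ)
    have h2 := Equiv.Perm.extendDomain_apply_image s Fin.equivSubtype i
    rw [show ((Fin.equivSubtype i : {j // j < a + b + 1}) : ℕ) = i from rfl] at h2
    rw [h2] at h1
    change _ = ((s i : Fin _) : ℕ) at h1
    rw [← h1, Equiv.swap_apply_def, Equiv.swap_apply_def]
    simp only [Fin.ext_iff]
    split_ifs <;> rfl
  rw [hs, finitarySign_extendDomain, e, Equiv.Perm.sign_swap]
  simpa using h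

/-- Here r may have infinite support, so multiplicativity is not available. Instead r carries the
moved points of σ onto those of the conjugate, and both sides take the junk value together. -/
theorem finitarySign_conj (σ r : Equiv.Perm ℕ) :
    finitarySign (r * σ * r⁻¹) = finitarySign σ := by
  classical
  have e : {i | (r * σ * r⁻¹) i ≠ i} = r '' {i | σ i ≠ i} := by
    ext i
    simp only [Set.mem_ofPred_eq, Set.mem_image_equiv, Equiv.Perm.mul_apply]
    rw [ne_eq, ne_eq, ← Equiv.eq_symm_apply]
    rfl
  by_cases h : {i | σ i ≠ i}.Finite
  · have h' : {i | (r * σ * r⁻¹) i ≠ i}.Finite := by rw [e]; exact h.image r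
    rw [finitarySign, finitarySign, dif_pos h, dif_pos h']
    let : Fintype {i // σ i ≠ i} := h.fintype
    let : Fintype {i // (r * σ * r⁻¹) i ≠ i} := h'.fintype
    symm
    convert Equiv.Perm.sign_eq_sign_of_equiv
      (σ.subtypePerm (p := fun i => σ i ≠ i) (fun _ => by simp))
      ((r * σ * r⁻¹).subtypePerm (p := fun i => (r * σ * r⁻¹) i ≠ i)
        (fun _ => (r * σ * r⁻¹).injective.ne_iff))
      (r.subtypeEquiv fun i => by
        change _ ↔ r (σ (r⁻¹ (r i))) ≠ r i
        rw [r.injective.ne_iff]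
        simp) ?_
    rintro ⟨x, hx⟩
    apply Subtype.ext
    change r (σ x) = r (σ (r⁻¹ (r x)))
    simp
  · have h' : ¬ {i | (r * σ * r⁻¹) i ≠ i}.Finite := by
      rw [e]
      exact fun hf => h (hf.of_finite_image r.injective.injOn)
    rw [finitarySign, finitarySign, dif_neg h, dif_neg h']

/-! ### The action on power series -/

section

variable {α : Type} (v w : Equiv.Perm α) (F G : MvPowerSeries α ℚ)

theorem coeff_equivMapDomain_permAct (m : α →₀ ℕ) :
    MvPowerSeries.coeff (m.equivMapDomain v) (permAct v F) = MvPowerSeries.coeff m F := by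
  have h := MvPowerSeries.coeff_embDomain_rename v.toEmbedding F m
  rw [Finsupp.embDomain_eq_mapDomain] at h
  rw [Finsupp.equivMapDomain_eq_mapDomain]
  exact h

theorem coeff_permAct (m : α →₀ ℕ) :
    MvPowerSeries.coeff m (permAct v F) = MvPowerSeries.coeff (m.equivMapDomain v⁻¹) F := by
  rw [← coeff_equivMapDomain_permAct v F (m.equivMapDomain v⁻¹)]
  congr 2
  ext i
  rw [Finsupp.equivMapDomain_apply, Finsupp.equivMapDomain_apply]
  exact congrArg m (v.apply_symm_apply i).symm

theorem permAct_mul_perm : permAct (v * w) F = permAct v (permAct w F) := by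
  ext m
  rw [coeff_permAct, coeff_permAct, coeff_permAct, ← Finsupp.equivMapDomain_trans]
  rw [mul_inv_rev]
  rfl

theorem permAct_mul : permAct v (F * G) = permAct v F * permAct v G := map_mul _ _ _

theorem permAct_one : permAct v (1 : MvPowerSeries α ℚ) = 1 := map_one _

theorem permAct_add : permAct v (F + G) = permAct v F + permAct v G := map_add _ _ _

theorem permAct_sub : permAct v (F - G) = permAct v F - permAct v G := map_sub _ _ _

theorem permAct_smul (c : ℚ) : permAct v (c • F) = c • permAct v F := map_smul _ _ _

theorem permAct_sum {ι : Type} (s : Finset ι) (f : ι → MvPowerSeries α ℚ) :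
    permAct v (∑ i ∈ s, f i) = ∑ i ∈ s, permAct v (f i) := map_sum _ _ _

end

/-! ### Orbits under row-preserving permutations -/

/-- Orbits of exponents under row-preserving permutations are classified by the counts of the
non-zero values in each row. Zeros need no condition: in a finite row their number is what remains,
and in an infinite row they are countably infinite in any case. The same criterion therefore serves
`Fin n` and `ℕ`. -/
theorem exists_rowPreserving_iff {α : Type} [Countable α] (row : α → ℕ) (p m : α →₀ ℕ) :
    (∃ τ : Equiv.Perm α, (∀ i, row (τ i) = row i) ∧ m = p.equivMapDomain τ) ↔
      ∀ r h, h ≠ 0 → {k | row k = r ∧ m k = h}.ncard = {k | row k = r ∧ p k = h}.ncard := by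
  classical
  constructor
  · rintro ⟨τ, hτ, rfl⟩ r h -
    rw [← Set.ncard_image_of_injective {k | row k = r ∧ p k = h} τ.injective]
    congr 1
    ext k
    have := hτ (τ.symm k)
    simp only [Equiv.apply_symm_apply] at this
    simp [Set.mem_image_equiv, Finsupp.equivMapDomain_apply, this]
  · intro H
    have fin : ∀ (q : α →₀ ℕ) r h, h ≠ 0 → {k | row k = r ∧ q k = h}.Finite :=
      fun q r h hh => q.support.finite_toSet.subset fun k hk => by
        simp only [Finset.mem_coe, Finsupp.mem_support_iff]
        rw [hk.2]; exact hh
    -- The fibres of (row, exponent) are matched one at a time; `Equiv.ofFiberEquiv` then glues the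
    -- bijections to a permutation that preserves rows and carries p to m.
    have E : ∀ c : ℕ × ℕ, Nonempty ({k // (row k, p k) = c} ≃ {k // (row k, m k) = c}) := by
      rintro ⟨r, h⟩
      have conv : ∀ q : α →₀ ℕ, Nonempty ({k // (row k, q k) = (r, h)} ≃
          ↥{k | row k = r ∧ q k = h}) := fun q =>
        ⟨Equiv.subtypeEquivRight fun k => by simp⟩
      suffices Nonempty (↥{k | row k = r ∧ p k = h} ≃ ↥{k | row k = r ∧ m k = h}) by
        obtain ⟨a⟩ := conv p
        obtain ⟨b⟩ := conv m
        obtain ⟨t⟩ := this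
        exact ⟨a.trans (t.trans b.symm)⟩
      by_cases hh : h = 0
      · subst hh
        by_cases hr : {k | row k = r}.Finite
        -- V contains all values of both exponents, so in a finite row the zeros are counted by
        -- subtracting the non-zero counts from the row length.
        · set V : Finset ℕ := insert 0 (p.support.image p ∪ m.support.image m) with hV
          have hcard : ∀ q : α →₀ ℕ, (∀ k, q k ∈ V) →
              hr.toFinset.card = {k | row k = r ∧ q k = 0}.ncard +
                ∑ h ∈ V.erase 0, {k | row k = r ∧ q k = h}.ncard := by
            intro q hq
            rw [Finset.add_sum_erase V (fun h => {k | row k = r ∧ q k = h}.ncard)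
              (Finset.mem_insert_self _ _),
              Finset.card_eq_sum_card_fiberwise (f := q) (t := V) (fun k _ => hq k)]
            refine Finset.sum_congr rfl fun h _ => ?_
            rw [← Set.ncard_coe_finset]
            congr 1
            ext k
            simp
          have hp := hcard p fun k => by
            by_cases hk : p k = 0
            · rw [hk]; exact Finset.mem_insert_self _ _
            · exact Finset.mem_insert_of_mem (Finset.mem_union_left _
                (Finset.mem_image_of_mem _ (Finsupp.mem_support_iff.mpr hk)))
          have hm := hcard m fun k => by
            by_cases hk : m k = 0
            · rw [hk]; exact Finset.mem_insert_self _ _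
            · exact Finset.mem_insert_of_mem (Finset.mem_union_right _
                (Finset.mem_image_of_mem _ (Finsupp.mem_support_iff.mpr hk)))
          rw [Finset.sum_congr rfl fun h hh => H r h (Finset.ne_of_mem_erase hh)] at hm
          have : Finite ↥{k | row k = r ∧ p k = 0} := hr.subset fun k hk => hk.1
          have : Finite ↥{k | row k = r ∧ m k = 0} := hr.subset fun k hk => hk.1
          refine Finite.card_eq.mp ?_
          rw [Nat.card_coe_set_eq, Nat.card_coe_set_eq]
          omega
        · have inf : ∀ q : α →₀ ℕ, Infinite ↥{k | row k = r ∧ q k = 0} := fun q => by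
            rw [Set.infinite_coe_iff]
            have : {k | row k = r ∧ q k = 0} = {k | row k = r} \ (q.support : Set α) := by
              ext k; simp
            rw [this]
            exact Set.Infinite.sdiff hr q.support.finite_toSet
          have := inf p
          have := inf m
          exact nonempty_equiv_of_countable
      · have : Finite ↥{k | row k = r ∧ p k = h} := fin p r h hh
        have : Finite ↥{k | row k = r ∧ m k = h} := fin m r h hh
        refine Finite.card_eq.mp ?_
        rw [Nat.card_coe_set_eq, Nat.card_coe_set_eq, H r h hh]
    let e := fun c => (E c).some
    have hE : ∀ k, (row (Equiv.ofFiberEquiv e k), m (Equiv.ofFiberEquiv e k)) = (row k, p k) :=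
      fun k => Equiv.ofFiberEquiv_map e k
    refine ⟨Equiv.ofFiberEquiv e, fun i => (Prod.ext_iff.mp (hE i)).1, ?_⟩
    ext k
    have h := (Prod.ext_iff.mp (hE ((Equiv.ofFiberEquiv e).symm k))).2
    rw [Equiv.apply_symm_apply] at h
    rw [Finsupp.equivMapDomain_apply]
    exact h

/-! ### Column groups -/

namespace StdTableau

section General

variable {ι : Type} [LinearOrder ι] {D : Set (ℕ × ℕ)} (T : StdTableau ι D)

theorem box_injective : Function.Injective T.box := fun _ _ h =>
  T.bijOn.injOn (Set.mem_univ _) (Set.mem_univ _) h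

theorem box_mem (i : ι) : T.box i ∈ D := T.bijOn.mapsTo (Set.mem_univ i)

theorem exists_box_eq {c : ℕ × ℕ} (h : c ∈ D) : ∃ i, T.box i = c := by
  obtain ⟨i, -, hi⟩ := T.bijOn.surjOn h
  exact ⟨i, hi⟩

theorem colGroup_le_colTildeGroup : T.colGroup ≤ T.colTildeGroup := fun σ hσ i j => by
  rw [hσ i, hσ j]

theorem swap_mem_colGroup [DecidableEq ι] {a b : ι} (h : (T.box a).2 = (T.box b).2) :
    Equiv.swap a b ∈ T.colGroup := fun i => by
  rw [Equiv.swap_apply_def]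
  split_ifs with h1 h2
  · rw [h1, h]
  · rw [h2, h]
  · rfl

/-- An element of `C̃(T)` maps a column to a column that is at least as long. -/
theorem mem_of_mem_colTildeGroup (hD : IsLowerSet D) {σ : Equiv.Perm ι}
    (hσ : σ ∈ T.colTildeGroup) {i : ι} {a : ℕ} (ha : (a, (T.box i).2) ∈ D) :
    (a, (T.box (σ i)).2) ∈ D := by
  by_contra hc
  -- Pigeonhole: the a + 1 entries in rows 0, …, a of the column of i go injectively into one
  -- column, which would only have rows below a.
  have hb : ∀ b : Fin (a + 1), ∃ k, T.box k = ((b : ℕ), (T.box i).2) := fun b =>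
    T.exists_box_eq (hD (Prod.mk_le_mk.mpr ⟨Nat.lt_succ_iff.mp b.2, le_rfl⟩) ha)
  choose e he using hb
  have hcol : ∀ b, (T.box (σ (e b))).2 = (T.box (σ i)).2 := fun b =>
    (hσ _ _).mpr (by rw [he])
  have hrow : ∀ b, (T.box (σ (e b))).1 < a := fun b => by
    by_contra hlt
    refine hc (hD ?_ (T.box_mem (σ (e b))))
    exact Prod.le_def.mpr ⟨not_lt.mp hlt, (hcol b).ge⟩
  have inj : Function.Injective (fun b => (⟨(T.box (σ (e b))).1, hrow b⟩ : Fin a)) := by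
    intro b b' h
    have h1 := σ.injective (T.box_injective
      (Prod.ext (Fin.ext_iff.mp h) ((hcol b).trans (hcol b').symm)))
    have h2 := he b
    rw [h1, he b'] at h2
    exact Fin.ext (Prod.ext_iff.mp h2).1.symm
  simpa using Fintype.card_le_of_injective _ inj

/-- The row factor r sends i to the box in the row of i and the column of σ i. This box exists since
σ never shortens columns; then σ * r⁻¹ preserves every column. -/
theorem exists_eq_mul_of_mem_colTildeGroup (hD : IsLowerSet D) {σ : Equiv.Perm ι}
    (hσ : σ ∈ T.colTildeGroup) :
    ∃ c ∈ T.colGroup, ∃ r ∈ T.rowGroup ⊓ T.colTildeGroup, σ = c * r := by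
  have h : ∀ i, ∃ k, T.box k = ((T.box i).1, (T.box (σ i)).2) := fun i =>
    T.exists_box_eq (T.mem_of_mem_colTildeGroup hD hσ (T.box_mem i))
  choose f hf using h
  have inj : Function.Injective f := fun i j hij => by
    have h1 := hf i
    rw [hij, hf j] at h1
    obtain ⟨h2, h3⟩ := Prod.ext_iff.mp h1
    exact T.box_injective (Prod.ext h2.symm ((hσ _ _).mp h3.symm))
  have surj : Function.Surjective f := fun k => by
    -- Surjectivity is the length comparison for σ⁻¹: the preimage of k sits in the row of k, in the
    -- column of σ⁻¹ k.
    have h1 := T.mem_of_mem_colTildeGroup hD (inv_mem hσ) (T.box_mem k)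
    obtain ⟨i, hi⟩ := T.exists_box_eq h1
    refine ⟨i, T.box_injective ?_⟩
    rw [hf i, hi]
    refine Prod.ext rfl ?_
    have h2 : (T.box i).2 = (T.box (σ⁻¹ k)).2 := by rw [hi]
    have h3 := (hσ i (σ⁻¹ k)).mpr h2
    simpa using h3
  set r : Equiv.Perm ι := Equiv.ofBijective f ⟨inj, surj⟩ with hr
  have hrf : ∀ i, r i = f i := fun _ => rfl
  have hrow : r ∈ T.rowGroup := fun i => by rw [hrf, hf]
  have hcol : ∀ i, (T.box (r i)).2 = (T.box (σ i)).2 := fun i => by rw [hrf, hf]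
  have hc : σ * r⁻¹ ∈ T.colGroup := fun i => by
    rw [Equiv.Perm.mul_apply, ← hcol]
    simp
  refine ⟨σ * r⁻¹, hc, r, ⟨hrow, fun i j => ?_⟩, by simp⟩
  rw [hcol, hcol]
  exact hσ i j

theorem conj_mem_colGroup {r σ : Equiv.Perm ι} (hr : r ∈ T.colTildeGroup)
    (hσ : σ ∈ T.colGroup) : r * σ * r⁻¹ ∈ T.colGroup := fun i => by
  have h := (hr (σ (r⁻¹ i)) (r⁻¹ i)).mpr (hσ _)
  simpa using h

end General

section Infinite

variable {L : InfiniteFerrers} (T : StdTableau ℕ L.cells)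

/-- All but finitely many entries lie in columns with a single box. -/
theorem exists_forall_single_column :
    ∃ N, ∀ i, N ≤ i → ∀ c ∈ L.cells, c.2 = (T.box i).2 → c = T.box i := by
  -- The exceptional entries are those of the finite part and those of the first row directly above
  -- it.
  have fin : (T.box ⁻¹' L.finitePart ∪
      T.box ⁻¹' ((fun c : ℕ × ℕ => (0, c.2)) '' (L.finitePart : Set (ℕ × ℕ)))).Finite :=
    (L.finitePart.finite_toSet.preimage T.box_injective.injOn).union
      ((L.finitePart.finite_toSet.image _).preimage T.box_injective.injOn)
  obtain ⟨N, hN⟩ := fin.bddAbove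
  refine ⟨N + 1, fun i hi c hc h => ?_⟩
  have hni : ¬ _ := fun hbad => absurd (hN (a := i) hbad) (by omega)
  by_cases h0 : (T.box i).1 = 0
  · by_cases hc0 : c.1 = 0
    · exact Prod.ext (hc0.trans h0.symm) h
    · exact absurd (Or.inr ⟨c, by simp [InfiniteFerrers.finitePart, hc, hc0],
        Prod.ext h0.symm h⟩) hni
  · exact absurd (Or.inl (by simp [InfiniteFerrers.finitePart, h0, T.box_mem i])) hni

theorem exists_forall_colGroup_fix :
    ∃ N, ∀ σ ∈ T.colGroup, ∀ i, N ≤ i → σ i = i := by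
  obtain ⟨N, hN⟩ := T.exists_forall_single_column
  exact ⟨N, fun σ hσ i hi => T.box_injective (hN i hi _ (T.box_mem _) (hσ i))⟩

theorem finite_colGroup : (T.colGroup : Set (Equiv.Perm ℕ)).Finite := by
  obtain ⟨N, hN⟩ := T.exists_forall_colGroup_fix
  refine (Set.finite_range (fun τ : Equiv.Perm (Fin N) =>
    τ.extendDomain (Fin.equivSubtype))).subset fun σ hσ => ?_
  obtain ⟨τ, hτ⟩ := exists_eq_extendDomain (hN σ hσ)
  exact ⟨τ, hτ.symm⟩

theorem finitarySign_mul_of_mem_colGroup {σ τ : Equiv.Perm ℕ} (hσ : σ ∈ T.colGroup)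
    (hτ : τ ∈ T.colGroup) : finitarySign (σ * τ) = finitarySign σ * finitarySign τ := by
  obtain ⟨N, hN⟩ := T.exists_forall_colGroup_fix
  exact finitarySign_mul (hN σ hσ) (hN τ hτ)

/-- `C(T)` as a finite set. -/
noncomputable def colFinset : Finset (Equiv.Perm ℕ) := T.finite_colGroup.toFinset

theorem mem_colFinset {σ : Equiv.Perm ℕ} : σ ∈ T.colFinset ↔ σ ∈ T.colGroup := by
  simp [colFinset]

end Infinite

end StdTableau

/-! ### Equivariance of stable Specht polynomials -/

theorem coeff_orbitSeries (R : Subgroup (Equiv.Perm ℕ)) (p m : ℕ →₀ ℕ)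
    [Decidable (∃ τ ∈ R, m = p.equivMapDomain τ)] :
    MvPowerSeries.coeff m (orbitSeries R p) =
      if ∃ τ ∈ R, m = p.equivMapDomain τ then 1 else 0 := by
  simp only [orbitSeries, MvPowerSeries.coeff_apply]
  congr

theorem permAct_orbitSeries {R : Subgroup (Equiv.Perm ℕ)} {r : Equiv.Perm ℕ} (hr : r ∈ R)
    (p : ℕ →₀ ℕ) : permAct r (orbitSeries R p) = orbitSeries R p := by
  classical
  ext m
  rw [coeff_permAct, coeff_orbitSeries, coeff_orbitSeries]
  congr 1
  apply propext
  constructor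
  · rintro ⟨τ, hτ, h⟩
    refine ⟨r * τ, mul_mem hr hτ, ?_⟩
    have h1 := congrArg (Finsupp.equivMapDomain r) h
    rw [← Finsupp.equivMapDomain_trans, ← Finsupp.equivMapDomain_trans] at h1
    rw [show r⁻¹.trans r = Equiv.refl ℕ from Equiv.symm_trans_self r,
      Finsupp.equivMapDomain_refl] at h1
    exact h1
  · rintro ⟨τ, hτ, rfl⟩
    refine ⟨r⁻¹ * τ, mul_mem (inv_mem hr) hτ, ?_⟩
    rw [← Finsupp.equivMapDomain_trans]
    rfl

section

variable {L : InfiniteFerrers} (M : InfiniteSSYT L) (T : StdTableau ℕ L.cells)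

theorem stableSpecht_eq_sum : stableSpecht M T = ∑ σ ∈ T.colFinset,
    ((finitarySign σ : ℤ) : ℚ) • permAct σ (orbitSeries T.rowGroup (stableExponent M T)) :=
  finsum_mem_eq_finite_toFinset_sum _ T.finite_colGroup

theorem permAct_stableSpecht_of_mem_colGroup {c : Equiv.Perm ℕ} (hc : c ∈ T.colGroup) :
    permAct c (stableSpecht M T) = ((finitarySign c : ℤ) : ℚ) • stableSpecht M T := by
  rw [stableSpecht_eq_sum, permAct_sum, Finset.smul_sum]
  refine Finset.sum_equiv (Equiv.mulLeft c) (fun σ => ?_) (fun σ hσ => ?_)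
  · rw [T.mem_colFinset, T.mem_colFinset, Equiv.coe_mulLeft]
    exact (Subgroup.mul_mem_cancel_left _ hc).symm
  · rw [T.mem_colFinset] at hσ
    rw [permAct_smul, Equiv.coe_mulLeft, permAct_mul_perm,
      T.finitarySign_mul_of_mem_colGroup hc hσ, smul_smul]
    congr 1
    -- The sign of c now occurs twice on the right, and its square is 1.
    rcases Int.units_eq_one_or (finitarySign c) with h | h <;> rw [h] <;> simp

/-- Write r * σ = (r * σ * r⁻¹) * r: the last factor fixes the orbit sum, and conjugation by r
permutes `colGroup` while preserving signs. -/
theorem permAct_stableSpecht_of_mem_rowGroup {r : Equiv.Perm ℕ}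
    (hr : r ∈ T.rowGroup ⊓ T.colTildeGroup) :
    permAct r (stableSpecht M T) = stableSpecht M T := by
  rw [stableSpecht_eq_sum, permAct_sum]
  refine Finset.sum_equiv (MulAut.conj r).toEquiv (fun σ => ?_) (fun σ hσ => ?_)
  · rw [T.mem_colFinset, T.mem_colFinset]
    change _ ↔ r * σ * r⁻¹ ∈ _
    refine ⟨fun h => T.conj_mem_colGroup hr.2 h, fun h => ?_⟩
    have h' := T.conj_mem_colGroup (inv_mem hr.2) h
    simpa [mul_assoc] using h'
  · change _ = ((finitarySign (r * σ * r⁻¹) : ℤ) : ℚ) • permAct (r * σ * r⁻¹) _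
    rw [finitarySign_conj, permAct_smul, permAct_mul_perm, permAct_mul_perm,
      permAct_orbitSeries (inv_mem hr.1)]

theorem transformsBySgnTilde_stableSpecht : TransformsBySgnTilde T (stableSpecht M T) := by
  intro σ hσ
  obtain ⟨c, hc, r, hr, rfl⟩ := T.exists_eq_mul_of_mem_colTildeGroup L.isLowerSet hσ
  rw [sgnTilde_mul T hc hr, permAct_mul_perm, permAct_stableSpecht_of_mem_rowGroup M T hr,
    permAct_stableSpecht_of_mem_colGroup M T hc]

end

/-! ### Contents of monomials -/

theorem sum_monomialContent (m : ℕ →₀ ℕ) : (monomialContent m).sum = m.degree := rfl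

theorem card_monomialContent (m : ℕ →₀ ℕ) :
    Multiset.card (monomialContent m) = m.support.card := by
  simp [monomialContent]

theorem support_equivMapDomain_eq_map {α : Type} (v : Equiv.Perm α) (m : α →₀ ℕ) :
    (m.equivMapDomain v).support = m.support.map v.toEmbedding := by
  ext i
  simp [Finsupp.equivMapDomain_apply]

theorem monomialContent_equivMapDomain (v : Equiv.Perm ℕ) (m : ℕ →₀ ℕ) :
    monomialContent (m.equivMapDomain v) = monomialContent m := by
  rw [monomialContent, monomialContent, support_equivMapDomain_eq_map, Finset.map_val,
    Multiset.map_map]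
  refine Multiset.map_congr rfl fun i _ => ?_
  simp [Finsupp.equivMapDomain_apply]

theorem count_monomialContent (m : ℕ →₀ ℕ) {h : ℕ} (hh : h ≠ 0) :
    (monomialContent m).count h = {i | m i = h}.ncard := by
  rw [monomialContent, Multiset.count_map, ← Finset.filter_val, Finset.card_val,
    ← Set.ncard_coe_finset]
  congr 1
  ext i
  simp only [Finset.coe_filter, Finsupp.mem_support_iff, Set.mem_ofPred_eq]
  constructor
  · exact fun hi => hi.2.symm
  · rintro rfl
    exact ⟨hh, rfl⟩

theorem zero_notMem_monomialContent (m : ℕ →₀ ℕ) : 0 ∉ monomialContent m := by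
  simp [monomialContent]

section

variable {L : InfiniteFerrers} (M : InfiniteSSYT L) (T : StdTableau ℕ L.cells)

theorem InfiniteFerrers.mem_finitePart {c : ℕ × ℕ} :
    c ∈ L.finitePart ↔ c ∈ L.cells ∧ c.1 ≠ 0 := by
  simp [InfiniteFerrers.finitePart]

theorem InfiniteSSYT.zero_notMem_content : 0 ∉ M.content := by
  rw [InfiniteSSYT.content, Multiset.mem_add, not_or]
  constructor
  · rw [Multiset.mem_map]
    rintro ⟨c, hc, h⟩
    obtain ⟨h1, h2⟩ := InfiniteFerrers.mem_finitePart.mp hc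
    exact (M.pos h2 h1).ne' h
  · rw [Finsupp.mem_toMultiset]
    simpa using M.mult_zero

theorem InfiniteSSYT.count_content (h : ℕ) :
    M.content.count h =
      (L.finitePart.filter (fun c => M.entry c.1 c.2 = h)).card + M.mult h := by
  rw [InfiniteSSYT.content, Multiset.count_add, Finsupp.count_toMultiset, Multiset.count_map,
    ← Finset.filter_val, Finset.card_val]
  simp only [eq_comm]

/-- Each value is counted separately in the finite part and in the first row, so the arbitrary
choice of first-row variables does not matter. -/
theorem monomialContent_of_isStableExponent {p : ℕ →₀ ℕ} (hp : IsStableExponent M T p) :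
    monomialContent p = M.content := by
  ext h
  by_cases hh : h = 0
  · rw [hh, Multiset.count_eq_zero_of_notMem (zero_notMem_monomialContent p),
      Multiset.count_eq_zero_of_notMem M.zero_notMem_content]
  · have fin : {i | p i = h}.Finite := p.support.finite_toSet.subset fun i hi => by
      simp only [Finset.mem_coe, Finsupp.mem_support_iff]
      exact ne_of_eq_of_ne hi hh
    rw [count_monomialContent p hh, M.count_content, ← hp.2 h (Nat.pos_of_ne_zero hh)]
    have e : {i | p i = h} = {i | (T.box i).1 ≠ 0 ∧ p i = h} ∪ {i | (T.box i).1 = 0 ∧ p i = h} := by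
      ext i
      simp only [Set.mem_ofPred_eq, Set.mem_union]
      tauto
    rw [e, Set.ncard_union_eq ?_ (fin.subset fun i hi => hi.2) (fin.subset fun i hi => hi.2)]
    · congr 1
      rw [← Set.ncard_image_of_injective _ T.box_injective, ← Set.ncard_coe_finset]
      congr 1
      ext c
      simp only [Set.mem_image, Set.mem_ofPred_eq, Finset.coe_filter,
        InfiniteFerrers.mem_finitePart]
      constructor
      · rintro ⟨i, ⟨h1, h2⟩, rfl⟩
        exact ⟨⟨T.box_mem i, h1⟩, (hp.1 i h1).symm.trans h2⟩
      · rintro ⟨⟨h1, h2⟩, h3⟩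
        obtain ⟨i, rfl⟩ := T.exists_box_eq h1
        exact ⟨i, ⟨h2, (hp.1 i h2).trans h3⟩, rfl⟩
    · rw [Set.disjoint_left]
      exact fun i h1 h2 => h1.1 h2.1

theorem isStableExponent_stableExponent : IsStableExponent M T (stableExponent M T) :=
  (exists_isStableExponent M T).choose_spec

theorem monomialContent_of_coeff_stableSpecht_ne_zero {m : ℕ →₀ ℕ}
    (hm : MvPowerSeries.coeff m (stableSpecht M T) ≠ 0) : monomialContent m = M.content := by
  classical
  rw [stableSpecht_eq_sum, map_sum] at hm
  obtain ⟨σ, -, hσ⟩ := Finset.exists_ne_zero_of_sum_ne_zero hm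
  rw [map_smul, smul_eq_mul, coeff_permAct, coeff_orbitSeries] at hσ
  have h := right_ne_zero_of_mul hσ
  rw [ne_eq, ite_eq_right_iff, Classical.not_imp] at h
  obtain ⟨⟨τ, -, hτ⟩, -⟩ := h
  rw [← monomialContent_equivMapDomain σ⁻¹, hτ, monomialContent_equivMapDomain,
    monomialContent_of_isStableExponent M T (isStableExponent_stableExponent M T)]

/-- A permutation that fixes the entries in columns with several boxes is in `R(T) ∩ C̃(T)`. -/
theorem StdTableau.mem_rowGroup_inf_colTildeGroup {v : Equiv.Perm ℕ}
    (hv : ∀ i, v i ≠ i → ∀ c ∈ L.cells, c.2 = (T.box i).2 → c = T.box i) :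
    v ∈ T.rowGroup ⊓ T.colTildeGroup := by
  have hv' : ∀ i, v i ≠ i → ∀ c ∈ L.cells, c.2 = (T.box (v i)).2 → c = T.box (v i) :=
    fun i hi => hv (v i) fun h => hi (v.injective h)
  -- Every column meets the first row, so an entry alone in its column lies there.
  have row0 : ∀ i, (∀ c ∈ L.cells, c.2 = (T.box i).2 → c = T.box i) → (T.box i).1 = 0 :=
    fun i h => by rw [← h _ (L.first_row (T.box i).2) rfl]
  refine ⟨fun i => ?_, fun i j => ?_⟩
  · by_cases hi : v i = i
    · rw [hi]
    · rw [row0 _ (hv i hi), row0 _ (hv' i hi)]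
  · by_cases hi : v i = i
    · by_cases hj : v j = j
      · rw [hi, hj]
      · constructor
        · intro h
          have := v.injective (T.box_injective (hv' j hj _ (T.box_mem (v i)) h))
          rw [this]
        · intro h
          have := T.box_injective (hv j hj _ (T.box_mem i) h)
          rw [this]
    · constructor
      · intro h
        have := v.injective (T.box_injective (hv' i hi _ (T.box_mem (v j)) h.symm))
        rw [this]
      · intro h
        have := T.box_injective (hv i hi _ (T.box_mem j) h.symm)
        rw [this]

theorem stableSpecht_mem_evSymContent : stableSpecht M T ∈ evSymContent M.content := by
  refine ⟨⟨⟨M.content.sum, fun m hm => ?_⟩, ?_⟩,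
    fun m hm => monomialContent_of_coeff_stableSpecht_ne_zero M T hm⟩
  · rw [← monomialContent_of_coeff_stableSpecht_ne_zero M T hm, sum_monomialContent]
  -- A permutation fixing all indices below N moves only entries that are alone in their column.
  · obtain ⟨N, hN⟩ := T.exists_forall_single_column
    refine ⟨N, fun v hv => permAct_stableSpecht_of_mem_rowGroup M T
      (T.mem_rowGroup_inf_colTildeGroup fun i hi => hN i ?_)⟩
    by_contra h
    exact hi (hv i (not_le.mp h))

end

/-! ### Eventually symmetric functions -/

theorem mem_evSymDeg_iff {d : ℕ} {F : MvPowerSeries ℕ ℚ} :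
    F ∈ evSymDeg d ↔ (∃ n, ∀ v : Equiv.Perm ℕ, (∀ i < n, v i = i) → permAct v F = F) ∧
      IsHomogeneousSeries d F :=
  ⟨fun h => ⟨h.1.2, h.2⟩, fun h => ⟨⟨⟨d, fun m hm => (h.2 m hm).le⟩, h.1⟩, h.2⟩⟩

theorem evSymContent_subset_evSymDeg (μ : Multiset ℕ) : evSymContent μ ⊆ evSymDeg μ.sum :=
  fun F hF => ⟨hF.1, fun m hm => by rw [← hF.2 m hm, sum_monomialContent]⟩

/-- `Λ̃_μ` as a subspace. -/
def evSymContentSubmodule (μ : Multiset ℕ) : Submodule ℚ (MvPowerSeries ℕ ℚ) where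
  carrier := evSymContent μ
  zero_mem' := ⟨⟨⟨0, fun m hm => by simp at hm⟩, 0, fun v _ => map_zero _⟩,
    fun m hm => by simp at hm⟩
  add_mem' := by
    rintro F G ⟨⟨⟨a, ha⟩, n, hn⟩, hF⟩ ⟨⟨⟨b, hb⟩, k, hk⟩, hG⟩
    have key : ∀ m, MvPowerSeries.coeff m (F + G) ≠ 0 →
        MvPowerSeries.coeff m F ≠ 0 ∨ MvPowerSeries.coeff m G ≠ 0 := fun m hm => by
      by_contra! h
      exact hm (by rw [map_add, h.1, h.2, add_zero])
    refine ⟨⟨⟨max a b, fun m hm => ?_⟩, max n k, fun v hv => ?_⟩, fun m hm => ?_⟩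
    · rcases key m hm with h | h
      · exact le_max_of_le_left (ha m h)
      · exact le_max_of_le_right (hb m h)
    · rw [permAct_add, hn v fun i hi => hv i (lt_max_of_lt_left hi),
        hk v fun i hi => hv i (lt_max_of_lt_right hi)]
    · rcases key m hm with h | h
      · exact hF m h
      · exact hG m h
  smul_mem' := by
    rintro c F ⟨⟨⟨a, ha⟩, n, hn⟩, hF⟩
    have key : ∀ m, MvPowerSeries.coeff m (c • F) ≠ 0 → MvPowerSeries.coeff m F ≠ 0 :=
      fun m hm h => hm (by rw [map_smul, h, smul_zero])
    exact ⟨⟨⟨a, fun m hm => ha m (key m hm)⟩, n, fun v hv => by rw [permAct_smul, hn v hv]⟩,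
      fun m hm => hF m (key m hm)⟩

theorem one_mem_evSymDeg : (1 : MvPowerSeries ℕ ℚ) ∈ evSymDeg 0 := by
  classical
  refine mem_evSymDeg_iff.mpr ⟨⟨0, fun v _ => permAct_one v⟩, fun m hm => ?_⟩
  rw [MvPowerSeries.coeff_one] at hm
  have : m = 0 := by
    by_contra h
    exact hm (if_neg h)
  simp [this]

theorem mul_mem_evSymDeg {d e : ℕ} {F G : MvPowerSeries ℕ ℚ} (hF : F ∈ evSymDeg d)
    (hG : G ∈ evSymDeg e) : F * G ∈ evSymDeg (d + e) := by
  classical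
  obtain ⟨⟨n, hn⟩, hF⟩ := mem_evSymDeg_iff.mp hF
  obtain ⟨⟨k, hk⟩, hG⟩ := mem_evSymDeg_iff.mp hG
  refine mem_evSymDeg_iff.mpr ⟨⟨max n k, fun v hv => ?_⟩, fun m hm => ?_⟩
  · rw [permAct_mul, hn v fun i hi => hv i (lt_max_of_lt_left hi),
      hk v fun i hi => hv i (lt_max_of_lt_right hi)]
  · rw [MvPowerSeries.coeff_mul] at hm
    obtain ⟨⟨a, b⟩, hab, h⟩ := Finset.exists_ne_zero_of_sum_ne_zero hm
    rw [← Finset.HasAntidiagonal.mem_antidiagonal.mp hab, map_add, hF a (left_ne_zero_of_mul h),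
      hG b (right_ne_zero_of_mul h)]

theorem multiset_prod_mem_evSymDeg (s : Multiset ℕ) (f : ℕ → MvPowerSeries ℕ ℚ) (g : ℕ → ℕ)
    (h : ∀ i, f i ∈ evSymDeg (g i)) : (s.map f).prod ∈ evSymDeg (s.map g).sum := by
  induction s using Multiset.induction_on with
  | empty => exact one_mem_evSymDeg
  | cons a s ih =>
    rw [Multiset.map_cons, Multiset.map_cons, Multiset.prod_cons, Multiset.sum_cons]
    exact mul_mem_evSymDeg (h a) ih

theorem coeff_elemSymm (r : ℕ) (m : ℕ →₀ ℕ) [Decidable ((∀ i, m i ≤ 1) ∧ m.support.card = r)] :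
    MvPowerSeries.coeff m (elemSymm r) =
      if (∀ i, m i ≤ 1) ∧ m.support.card = r then 1 else 0 := by
  simp only [elemSymm, MvPowerSeries.coeff_apply]
  congr

theorem permAct_elemSymm (v : Equiv.Perm ℕ) (r : ℕ) : permAct v (elemSymm r) = elemSymm r := by
  classical
  ext m
  rw [coeff_permAct, coeff_elemSymm, coeff_elemSymm, support_equivMapDomain_eq_map,
    Finset.card_map]
  congr 2
  refine propext ⟨fun h i => ?_, fun h i => h _⟩
  have h1 := h (v⁻¹ i)
  rwa [Finsupp.equivMapDomain_apply, Equiv.symm_apply_apply] at h1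

theorem elemSymm_mem_evSymDeg (r : ℕ) : elemSymm r ∈ evSymDeg r := by
  classical
  refine mem_evSymDeg_iff.mpr ⟨⟨0, fun v _ => permAct_elemSymm v r⟩, fun m hm => ?_⟩
  rw [coeff_elemSymm, ne_eq, ite_eq_right_iff, Classical.not_imp] at hm
  obtain ⟨⟨h1, h2⟩, -⟩ := hm
  rw [← h2, Finset.card_eq_sum_ones]
  refine Finset.sum_congr rfl fun i hi => ?_
  exact le_antisymm (h1 i) (Nat.one_le_iff_ne_zero.mpr (Finsupp.mem_support_iff.mp hi))

/-- Double counting: an entry a is counted once for each h from 1 to a. This is why the degree of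
`stableSpechtHom` is the sum of I. -/
theorem sum_dspc (μ : Multiset ℕ) : (dspc μ).sum = μ.sum := by
  -- The upper limit is decoupled from the maximum, which would change during the induction on the
  -- multi-set.
  have key : ∀ (N : ℕ) (s : Multiset ℕ), (∀ a ∈ s, a ≤ N) →
      ∑ h ∈ Finset.Icc 1 N, Multiset.card (s.filter (fun a => h ≤ a)) = s.sum := by
    intro N s
    induction s using Multiset.induction_on with
    | empty => simp
    | cons a s ih =>
      intro hs
      rw [Multiset.sum_cons, ← ih fun b hb => hs b (Multiset.mem_cons_of_mem hb)]
      have h1 : ∀ h, Multiset.card ((a ::ₘ s).filter (fun b => h ≤ b)) =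
          (if h ≤ a then 1 else 0) + Multiset.card (s.filter (fun b => h ≤ b)) := fun h => by
        rw [Multiset.filter_cons, Multiset.card_add]
        split_ifs <;> simp
      rw [Finset.sum_congr rfl fun h _ => h1 h, Finset.sum_add_distrib, ← Finset.card_filter]
      congr 1
      have h2 : (Finset.Icc 1 N).filter (fun h => h ≤ a) = Finset.Icc 1 a := by
        ext h
        have := hs a (Multiset.mem_cons_self a s)
        simp only [Finset.mem_filter, Finset.mem_Icc]
        omega
      rw [h2, Nat.card_Icc, Nat.add_sub_cancel]
  exact key _ μ fun a ha => Multiset.le_sup ha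

section

variable {L : InfiniteFerrers} (M : InfiniteSSYT L) (T : StdTableau ℕ L.cells)

theorem stableSpecht_mem_evSymDeg : stableSpecht M T ∈ evSymDeg M.content.sum :=
  evSymContent_subset_evSymDeg _ (stableSpecht_mem_evSymContent M T)

theorem stableSpechtSpace_le : stableSpechtSpace M ≤ evSymContentSubmodule M.content := by
  rw [stableSpechtSpace, Submodule.span_le]
  rintro _ ⟨T, rfl⟩
  exact stableSpecht_mem_evSymContent M T

theorem stableSpechtSet_mem_evSymDeg (I : Finset ℕ) :
    stableSpechtSet M T I ∈ evSymDeg (stableSetDegree M I) :=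
  mul_mem_evSymDeg (stableSpecht_mem_evSymDeg M T)
    (multiset_prod_mem_evSymDeg _ _ _ fun _ => elemSymm_mem_evSymDeg _)

theorem stableSpechtHom_mem_evSymDeg {I : Multiset ℕ} (hI : dspc M.content ≤ I) :
    stableSpechtHom M T I ∈ evSymDeg I.sum := by
  have h : I.sum = M.content.sum + ((I - dspc M.content).map id).sum := by
    rw [Multiset.map_id, ← sum_dspc M.content, ← Multiset.sum_add, add_tsub_cancel_of_le hI]
  rw [h]
  exact mul_mem_evSymDeg (stableSpecht_mem_evSymDeg M T)
    (multiset_prod_mem_evSymDeg _ _ _ fun _ => elemSymm_mem_evSymDeg _)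

theorem stableSpechtSpaceMul_subset (h : ℕ →₀ ℕ) :
    stableSpechtSpaceMul M h ⊆ evSymDeg (M.content.sum + h.sum (fun r k => k * r)) := by
  rintro _ ⟨F, hF, rfl⟩
  refine mul_mem_evSymDeg (evSymContent_subset_evSymDeg _ (stableSpechtSpace_le M hF)) ?_
  have hpow : ∀ r k, elemSymm r ^ k ∈ evSymDeg (k * r) := fun r k => by
    induction k with
    | zero => rw [pow_zero, zero_mul]; exact one_mem_evSymDeg
    | succ k ih => rw [pow_succ, add_mul, one_mul]; exact mul_mem_evSymDeg ih
                    (elemSymm_mem_evSymDeg r)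
  exact multiset_prod_mem_evSymDeg h.support.val _ _ fun r => hpow r (h r)

theorem TransformsBySgnTilde.mul_of_permAct_eq {F E : MvPowerSeries ℕ ℚ}
    (hF : TransformsBySgnTilde T F) (hE : ∀ v, permAct v E = E) :
    TransformsBySgnTilde T (F * E) := fun σ hσ => by
  rw [permAct_mul, hF σ hσ, hE, smul_mul_assoc]

theorem permAct_multiset_prod_elemSymm (s : Multiset ℕ) (g : ℕ → ℕ) (v : Equiv.Perm ℕ) :
    permAct v (s.map (fun i => elemSymm (g i))).prod =
      (s.map (fun i => elemSymm (g i))).prod := by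
  induction s using Multiset.induction_on with
  | empty => exact permAct_one v
  | cons a s ih =>
    rw [Multiset.map_cons, Multiset.prod_cons, permAct_mul, ih, permAct_elemSymm]

theorem transformsBySgnTilde_stableSpechtHom (I : Multiset ℕ) :
    TransformsBySgnTilde T (stableSpechtHom M T I) :=
  (transformsBySgnTilde_stableSpecht M T).mul_of_permAct_eq T
    (permAct_multiset_prod_elemSymm _ id)

theorem transformsBySgnTilde_stableSpechtSet (I : Finset ℕ) :
    TransformsBySgnTilde T (stableSpechtSet M T I) :=
  (transformsBySgnTilde_stableSpecht M T).mul_of_permAct_eq T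
    (permAct_multiset_prod_elemSymm _ _)

end

/-! ### Restriction to finitely many variables -/

theorem coeff_restrictVars {n : ℕ} (m : Fin n →₀ ℕ) (F : MvPowerSeries ℕ ℚ) :
    MvPowerSeries.coeff m (restrictVars n F) =
      MvPowerSeries.coeff (m.embDomain Fin.valEmbedding) F :=
  MvPowerSeries.coeff_killCompl F m

theorem restrictVars_mul (n : ℕ) (F G : MvPowerSeries ℕ ℚ) :
    restrictVars n (F * G) = restrictVars n F * restrictVars n G := map_mul _ _ _

theorem restrictVars_sub (n : ℕ) (F G : MvPowerSeries ℕ ℚ) :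
    restrictVars n (F - G) = restrictVars n F - restrictVars n G := map_sub _ _ _

theorem sum_single_one_eq_iff {α : Type} (t : Finset α) (m : α →₀ ℕ) :
    ∑ i ∈ t, Finsupp.single i 1 = m ↔ (∀ i, m i ≤ 1) ∧ m.support = t := by
  classical
  have happ : ∀ i, (∑ j ∈ t, Finsupp.single j 1 : α →₀ ℕ) i = if i ∈ t then 1 else 0 :=
    fun i => by
      rw [Finsupp.finsetSum_apply]
      simp [Finsupp.single_apply]
  constructor
  · rintro rfl
    refine ⟨fun i => ?_, ?_⟩
    · rw [happ]; split_ifs <;> simp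
    · ext i
      rw [Finsupp.mem_support_iff, happ]
      simp
  · rintro ⟨h1, rfl⟩
    ext i
    rw [happ]
    have := h1 i
    split_ifs with h
    · have := Finsupp.mem_support_iff.mp h
      omega
    · exact (Finsupp.notMem_support_iff.mp h).symm

theorem restrictVars_elemSymm (n r : ℕ) :
    restrictVars n (elemSymm r) =
      (MvPolynomial.esymm (Fin n) ℚ r : MvPowerSeries (Fin n) ℚ) := by
  classical
  ext m
  rw [coeff_restrictVars, coeff_elemSymm, MvPolynomial.coeff_coe,
    MvPolynomial.esymm_eq_sum_monomial, MvPolynomial.coeff_sum]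
  simp only [MvPolynomial.coeff_monomial, sum_single_one_eq_iff]
  have h1 : (∀ i, (m.embDomain Fin.valEmbedding) i ≤ 1) ↔ ∀ i, m i ≤ 1 := by
    constructor
    · intro h i
      have := h (Fin.valEmbedding i)
      rwa [Finsupp.embDomain_apply_self] at this
    · intro h i
      by_cases hi : i ∈ Set.range (Fin.valEmbedding : Fin n ↪ ℕ)
      · obtain ⟨k, rfl⟩ := hi
        rw [Finsupp.embDomain_apply_self]
        exact h k
      · rw [Finsupp.embDomain_of_notMem_range _ _ _ hi]
        exact zero_le
  rw [h1, Finsupp.support_embDomain, Finset.card_map]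
  by_cases hm : ∀ i, m i ≤ 1
  · simp only [hm, implies_true, true_and]
    rw [Finset.sum_ite_eq]
    simp [Finset.mem_powersetCard]
  · simp [hm]

/-! ### Coefficients of finite Specht polynomials -/

theorem MvPolynomial.coeff_rename_perm {α : Type} (v : Equiv.Perm α) (F : MvPolynomial α ℚ)
    (m : α →₀ ℕ) : MvPolynomial.coeff m (MvPolynomial.rename v F) =
      MvPolynomial.coeff (m.equivMapDomain v⁻¹) F := by
  have e : (m.equivMapDomain v⁻¹).mapDomain v = m := by
    rw [← Finsupp.equivMapDomain_eq_mapDomain]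
    ext i
    rw [Finsupp.equivMapDomain_apply, Finsupp.equivMapDomain_apply]
    exact congrArg m (v.apply_symm_apply i)
  conv_lhs => rw [← e]
  exact MvPolynomial.coeff_rename_mapDomain v v.injective F _

open scoped Classical in
-- This form matches the coefficients of `stableSpecht` term by term and exposes the orbit condition
-- to `exists_rowPreserving_iff`.
theorem coeff_spechtPoly {n : ℕ} {lam : YoungDiagram} (M : SemistandardYoungTableau lam)
    (T : StdTableau (Fin n) (lam : Set (ℕ × ℕ))) (m : Fin n →₀ ℕ) :
    MvPolynomial.coeff m (spechtPoly M T) =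
      ∑ σ ∈ Finset.univ.filter (fun σ : Equiv.Perm (Fin n) => σ ∈ T.colGroup),
        ((Equiv.Perm.sign σ : ℤ) : ℚ) *
          if ∃ τ : Equiv.Perm (Fin n), (∀ i, (T.box (τ i)).1 = (T.box i).1) ∧
            m.equivMapDomain σ⁻¹ = (finiteExponent M T).equivMapDomain τ then 1 else 0 := by
  rw [spechtPoly, MvPolynomial.coeff_sum]
  refine Finset.sum_congr rfl fun σ _ => ?_
  rw [MvPolynomial.coeff_smul, smul_eq_mul, MvPolynomial.coeff_rename_perm,
    MvPolynomial.coeff_sum]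
  simp only [MvPolynomial.coeff_monomial]
  rw [Finset.sum_ite_eq']
  congr 2
  simp only [Finset.mem_image, Finset.mem_filter_univ, eq_iff_iff]
  exact ⟨fun ⟨τ, h1, h2⟩ => ⟨τ, h1, h2.symm⟩, fun ⟨τ, h1, h2⟩ => ⟨τ, h1, h2.symm⟩⟩

/-! ### Comparison of finite and infinite tableaux -/

section

variable {n : ℕ} {lam : YoungDiagram} {L : InfiniteFerrers}
  {T : StdTableau (Fin n) (lam : Set (ℕ × ℕ))} {That : StdTableau ℕ L.cells}
  {M : SemistandardYoungTableau lam} {Mhat : InfiniteSSYT L}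

theorem SSYTProduces.mem_of_mem_cells (hM : SSYTProduces M Mhat) {c : ℕ × ℕ} (hc : c ∈ L.cells)
    (h0 : c.1 ≠ 0) : c ∈ lam := (hM.1 c.1 c.2 h0).mpr hc

theorem SSYTProduces.snd_lt_rowLen_one (hM : SSYTProduces M Mhat) {c : ℕ × ℕ} (hc : c ∈ L.cells)
    (h0 : c.1 ≠ 0) : c.2 < lam.rowLen 1 := by
  have h1 : (1, c.2) ∈ lam :=
    lam.isLowerSet (Prod.mk_le_mk.mpr ⟨Nat.one_le_iff_ne_zero.mpr h0, le_rfl⟩)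
      (hM.mem_of_mem_cells hc h0)
  exact YoungDiagram.mem_iff_lt_rowLen.mp h1

/-- Rows are counted from 0, so `lam.rowLen 1` is λ₂, and a column with index at least λ₂ holds only
its first-row box. -/
theorem SSYTProduces.single_column (hM : SSYTProduces M Mhat) (That : StdTableau ℕ L.cells)
    {i : ℕ} (hi : lam.rowLen 1 ≤ (That.box i).2) {c : ℕ × ℕ} (hc : c ∈ L.cells)
    (h : c.2 = (That.box i).2) : c = That.box i := by
  have key : ∀ d ∈ L.cells, d.2 = (That.box i).2 → d.1 = 0 := fun d hd h' => by
    by_contra h0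
    have := hM.snd_lt_rowLen_one hd h0
    omega
  exact Prod.ext ((key c hc h).trans (key _ (That.box_mem i) rfl).symm) h

theorem TableauProduces.box_of_le (hT : TableauProduces T That) {i : ℕ} (hi : n ≤ i) :
    That.box i = (0, lam.rowLen 0 + (i - n)) := by
  rw [← hT.2 (i - n), Nat.add_sub_cancel' hi]

theorem TableauProduces.colGroup_fix (hT : TableauProduces T That) (hM : SSYTProduces M Mhat)
    {σ : Equiv.Perm ℕ} (hσ : σ ∈ That.colGroup) {i : ℕ} (hi : n ≤ i) : σ i = i := by
  refine That.box_injective (hM.single_column That ?_ (That.box_mem _) (hσ i))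
  rw [hT.box_of_le hi]
  exact (lam.rowLen_anti 0 1 zero_le_one).trans (Nat.le_add_right _ _)

theorem TableauProduces.extendDomain_mem_colGroup_iff (hT : TableauProduces T That)
    (σ : Equiv.Perm (Fin n)) :
    σ.extendDomain (Fin.equivSubtype (n := n)) ∈ That.colGroup ↔ σ ∈ T.colGroup := by
  have happ : ∀ i : Fin n, σ.extendDomain (Fin.equivSubtype (n := n)) (i : ℕ) = σ i := fun i =>
    Equiv.Perm.extendDomain_apply_image σ Fin.equivSubtype i
  constructor
  · intro h i
    have := h i
    rwa [happ, hT.1, hT.1] at this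
  · intro h i
    by_cases hi : i < n
    · obtain ⟨k, rfl⟩ : ∃ k : Fin n, (k : ℕ) = i := ⟨⟨i, hi⟩, rfl⟩
      rw [happ, hT.1, hT.1]
      exact h k
    · rw [Equiv.Perm.extendDomain_apply_not_subtype (p := fun j => j < n) _ _ hi]

theorem embDomain_equivMapDomain_extendDomain (σ : Equiv.Perm (Fin n)) (m : Fin n →₀ ℕ) :
    (m.embDomain Fin.valEmbedding).equivMapDomain
      (σ.extendDomain (Fin.equivSubtype (n := n)))⁻¹ =
        (m.equivMapDomain σ⁻¹).embDomain Fin.valEmbedding := by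
  ext i
  change (m.embDomain Fin.valEmbedding) (σ.extendDomain (Fin.equivSubtype (n := n)) i) = _
  by_cases hi : i < n
  · obtain ⟨k, rfl⟩ : ∃ k : Fin n, Fin.valEmbedding k = i := ⟨⟨i, hi⟩, rfl⟩
    have h1 : σ.extendDomain (Fin.equivSubtype (n := n)) (Fin.valEmbedding k) =
        Fin.valEmbedding (σ k) := Equiv.Perm.extendDomain_apply_image σ Fin.equivSubtype k
    rw [h1, Finsupp.embDomain_apply_self, Finsupp.embDomain_apply_self]
    rfl
  · have hr : i ∉ Set.range (Fin.valEmbedding : Fin n ↪ ℕ) := by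
      rintro ⟨k, rfl⟩
      exact hi k.2
    rw [Equiv.Perm.extendDomain_apply_not_subtype (p := fun j => j < n) _ _ hi,
      Finsupp.embDomain_of_notMem_range _ _ _ hr, Finsupp.embDomain_of_notMem_range _ _ _ hr]

theorem TableauProduces.ncard_embDomain (hT : TableauProduces T That) (q : Fin n →₀ ℕ) (r : ℕ)
    {h : ℕ} (hh : h ≠ 0) :
    {k | (That.box k).1 = r ∧ q.embDomain Fin.valEmbedding k = h}.ncard =
      {k | (T.box k).1 = r ∧ q k = h}.ncard := by
  rw [← Set.ncard_image_of_injective {k | (T.box k).1 = r ∧ q k = h}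
    (Fin.valEmbedding : Fin n ↪ ℕ).injective]
  congr 1
  ext k
  constructor
  · rintro ⟨h1, h2⟩
    have hk : k ∈ Set.range (Fin.valEmbedding : Fin n ↪ ℕ) := by
      by_contra hc
      rw [Finsupp.embDomain_of_notMem_range _ _ _ hc] at h2
      exact hh h2.symm
    obtain ⟨j, rfl⟩ := hk
    rw [Finsupp.embDomain_apply_self] at h2
    refine ⟨j, ⟨?_, h2⟩, rfl⟩
    rw [← h1, ← hT.1]
    rfl
  · rintro ⟨j, ⟨h1, h2⟩, rfl⟩
    refine ⟨?_, by rw [Finsupp.embDomain_apply_self, h2]⟩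
    rw [← h1, ← hT.1]
    rfl

theorem finiteExponent_apply (i : Fin n) :
    finiteExponent M T i = M (T.box i).1 (T.box i).2 := rfl

/-- In the first row both counts are the multiplicity of h, and below it the exponents agree box by
box. Since only counts enter, the choice made in `stableExponent` drops out. -/
theorem ncard_stableExponent (hT : TableauProduces T That) (hM : SSYTProduces M Mhat) (r : ℕ)
    {h : ℕ} (hh : h ≠ 0) :
    {k | (That.box k).1 = r ∧ stableExponent Mhat That k = h}.ncard =
      {k | (T.box k).1 = r ∧ finiteExponent M T k = h}.ncard := by
  have hp := isStableExponent_stableExponent Mhat That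
  by_cases hr : r = 0
  · subst hr
    rw [hp.2 h (Nat.pos_of_ne_zero hh), hM.2.2 h (Nat.pos_of_ne_zero hh),
      ← Set.InjOn.ncard_image (f := fun k => (T.box k).2), ← Set.ncard_coe_finset]
    · congr 1
      ext j
      simp only [Finset.coe_filter, Finset.mem_range, Set.mem_ofPred_eq, Set.mem_image,
        finiteExponent_apply]
      constructor
      · rintro ⟨h1, h2⟩
        obtain ⟨k, hk⟩ := T.exists_box_eq (c := (0, j)) (YoungDiagram.mem_iff_lt_rowLen.mpr h1)
        exact ⟨k, ⟨by rw [hk], by rw [hk]; exact h2⟩, by rw [hk]⟩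
      · rintro ⟨k, ⟨h1, h2⟩, rfl⟩
        rw [h1] at h2
        refine ⟨YoungDiagram.mem_iff_lt_rowLen.mp ?_, h2⟩
        rw [← h1]
        exact T.box_mem k
    · intro a ha b hb hab
      exact T.box_injective (Prod.ext (ha.1.trans hb.1.symm) hab)
  · rw [← hT.ncard_embDomain _ _ hh]
    congr 1
    ext k
    refine and_congr_right fun hk => ?_
    have hk0 : (That.box k).1 ≠ 0 := hk ▸ hr
    have hkn : k < n := by
      by_contra hc
      rw [hT.box_of_le (not_lt.mp hc)] at hk0
      exact hk0 rfl
    rw [hp.1 k hk0, ← hM.2.1 _ _ hk0, show k = Fin.valEmbedding (⟨k, hkn⟩ : Fin n) from rfl,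
      Finsupp.embDomain_apply_self, finiteExponent_apply,
      ← hT.1 ⟨k, hkn⟩]
    rfl

/-- Extending permutations by the identity identifies the two column groups with their signs. For
each of them, the two orbit conditions become the same equalities of row counts. -/
theorem restrictVars_stableSpecht (hT : TableauProduces T That) (hM : SSYTProduces M Mhat) :
    restrictVars n (stableSpecht Mhat That) = (spechtPoly M T : MvPowerSeries (Fin n) ℚ) := by
  classical
  ext m
  rw [coeff_restrictVars, MvPolynomial.coeff_coe, coeff_spechtPoly, stableSpecht_eq_sum, map_sum]
  symm
  refine Finset.sum_bij (fun σ _ => σ.extendDomain (Fin.equivSubtype (n := n))) ?_ ?_ ?_ ?_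
  · intro σ hσ
    rw [That.mem_colFinset, hT.extendDomain_mem_colGroup_iff]
    simpa using hσ
  · intro σ _ τ _ h
    exact Equiv.Perm.extendDomainHom_injective _ h
  · intro σ hσ
    rw [That.mem_colFinset] at hσ
    obtain ⟨τ, rfl⟩ := exists_eq_extendDomain fun i hi => hT.colGroup_fix hM hσ hi
    exact ⟨τ, by simpa using (hT.extendDomain_mem_colGroup_iff τ).mp hσ, rfl⟩
  · intro σ _
    rw [map_smul, smul_eq_mul, finitarySign_extendDomain, coeff_permAct, coeff_orbitSeries,
      embDomain_equivMapDomain_extendDomain]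
    congr 2
    apply propext
    have h1 := exists_rowPreserving_iff (fun i => (T.box i).1) (finiteExponent M T)
      (m.equivMapDomain σ⁻¹)
    have h2 := exists_rowPreserving_iff (fun i => (That.box i).1) (stableExponent Mhat That)
      ((m.equivMapDomain σ⁻¹).embDomain Fin.valEmbedding)
    refine h1.trans (Iff.trans ?_ h2.symm)
    refine forall_congr' fun r => forall_congr' fun h => forall_congr' fun hh => ?_
    rw [hT.ncard_embDomain _ _ hh, ncard_stableExponent hT hM r hh]

/-! ### Products with elementary symmetric functions -/

/-- Only levels h ≥ 1 are counted, so the zeros, which occur in the finite content but not in the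
infinite one, are invisible. -/
theorem dspc_filter_pos (μ : Multiset ℕ) : dspc (μ.filter (0 < ·)) = dspc μ := by
  have hsup : (μ.filter (0 < ·)).sup = μ.sup := by
    refine le_antisymm (Multiset.sup_mono (Multiset.filter_subset _ _))
      (Multiset.sup_le.mpr fun a ha => ?_)
    rcases Nat.eq_zero_or_pos a with rfl | h
    · exact zero_le
    · exact Multiset.le_sup (Multiset.mem_filter.mpr ⟨ha, h⟩)
  rw [dspc, dspc, hsup]
  refine Multiset.map_congr rfl fun h hh => ?_
  have hpos : 1 ≤ h := (Finset.mem_Icc.mp hh).1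
  rw [Multiset.filter_filter]
  congr 1
  refine Multiset.filter_congr fun a _ => ?_
  constructor
  · exact fun h => h.1
  · exact fun h => ⟨h, by omega⟩

theorem SSYTProduces.filter_pos_content (hM : SSYTProduces M Mhat) :
    M.content.filter (0 < ·) = Mhat.content := by
  classical
  ext h
  rcases Nat.eq_zero_or_pos h with rfl | hh
  · rw [Multiset.count_eq_zero_of_notMem Mhat.zero_notMem_content,
      Multiset.count_eq_zero_of_notMem]
    simp
  · rw [Multiset.count_filter_of_pos (p := (0 < ·)) hh, Mhat.count_content, hM.2.2 h hh,
      SemistandardYoungTableau.content, Multiset.count_map, ← Finset.filter_val, Finset.card_val,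
      ← Finset.card_filter_add_card_filter_not (fun c : ℕ × ℕ => c.1 ≠ 0)]
    congr 1
    · congr 1
      ext c
      simp only [Finset.mem_filter, InfiniteFerrers.mem_finitePart, YoungDiagram.mem_cells]
      constructor
      · rintro ⟨⟨h1, h2⟩, h3⟩
        exact ⟨⟨(hM.1 _ _ h3).mp h1, h3⟩, by rw [← hM.2.1 _ _ h3, h2]⟩
      · rintro ⟨⟨h1, h2⟩, h3⟩
        exact ⟨⟨(hM.1 _ _ h2).mpr h1, by rw [hM.2.1 _ _ h2, h3]⟩, h2⟩
    · symm
      refine Finset.card_bij (fun j _ => (0, j)) ?_ ?_ ?_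
      · intro j hj
        simp only [Finset.mem_filter, Finset.mem_range] at hj
        simp [YoungDiagram.mem_iff_lt_rowLen, hj.1, hj.2]
      · intro a _ b _ hab
        exact (Prod.ext_iff.mp hab).2
      · rintro ⟨i, j⟩ hc
        simp only [Finset.mem_filter, YoungDiagram.mem_cells, not_not] at hc
        obtain ⟨⟨h1, h2⟩, rfl⟩ := hc
        refine ⟨j, ?_, rfl⟩
        simp only [Finset.mem_filter, Finset.mem_range]
        exact ⟨YoungDiagram.mem_iff_lt_rowLen.mp h1, h2.symm⟩

theorem SSYTProduces.dspc_content (hM : SSYTProduces M Mhat) :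
    dspc M.content = dspc Mhat.content := by
  rw [← hM.filter_pos_content, dspc_filter_pos]

theorem restrictVars_multiset_prod_elemSymm (s : Multiset ℕ) (f g : ℕ → ℕ)
    (h : ∀ i ∈ s, f i = g i) :
    restrictVars n (s.map (fun i => elemSymm (f i))).prod =
      ((s.map (fun i => MvPolynomial.esymm (Fin n) ℚ (g i))).prod :
        MvPowerSeries (Fin n) ℚ) := by
  induction s using Multiset.induction_on with
  | empty =>
    rw [Multiset.map_zero, Multiset.map_zero, Multiset.prod_zero, Multiset.prod_zero,
      MvPolynomial.coe_one]
    exact map_one _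
  | cons a s ih =>
    rw [Multiset.map_cons, Multiset.map_cons, Multiset.prod_cons, Multiset.prod_cons,
      restrictVars_mul, ih fun i hi => h i (Multiset.mem_cons_of_mem hi), restrictVars_elemSymm,
      MvPolynomial.coe_mul, h a (Multiset.mem_cons_self a s)]

theorem restrictVars_stableSpechtHom (hT : TableauProduces T That) (hM : SSYTProduces M Mhat)
    (I : Multiset ℕ) : restrictVars n (stableSpechtHom Mhat That I) =
      (spechtPolyHom M T I : MvPowerSeries (Fin n) ℚ) := by
  rw [stableSpechtHom, spechtPolyHom, restrictVars_mul, restrictVars_stableSpecht hT hM,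
    MvPolynomial.coe_mul, hM.dspc_content]
  congr 1
  exact restrictVars_multiset_prod_elemSymm _ id id fun _ _ => rfl

theorem stableR_eq_finiteR {I : Finset ℕ} {i : ℕ} (hi : i ≤ n) : stableR I i = finiteR n I i := by
  rw [stableR, finiteR]
  congr 1
  ext j
  simp only [Finset.mem_filter, Finset.mem_Ico, Finset.mem_sdiff]
  constructor
  · rintro ⟨⟨h1, h2⟩, h3⟩
    exact ⟨⟨⟨h1, by omega⟩, h3⟩, h2⟩
  · rintro ⟨⟨⟨h1, -⟩, h3⟩, h2⟩
    exact ⟨⟨h1, h2⟩, h3⟩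

theorem restrictVars_stableSpechtSet (hT : TableauProduces T That) (hM : SSYTProduces M Mhat)
    {I : Finset ℕ} (hI : ∀ i ∈ I, i ≤ n) : restrictVars n (stableSpechtSet Mhat That I) =
      (spechtPolySet M T I : MvPowerSeries (Fin n) ℚ) := by
  rw [stableSpechtSet, spechtPolySet, restrictVars_mul, restrictVars_stableSpecht hT hM,
    MvPolynomial.coe_mul, hM.dspc_content]
  congr 1
  refine restrictVars_multiset_prod_elemSymm _ _ _ fun i hi => stableR_eq_finiteR (hI i ?_)
  exact Multiset.mem_of_le tsub_le_self hi

end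

/-! ### Non-vanishing of finite Specht polynomials -/

section

variable {n : ℕ} {lam : YoungDiagram} (M : SemistandardYoungTableau lam)
  (T : StdTableau (Fin n) (lam : Set (ℕ × ℕ)))

/-- Induction on rows: once the rows above r are fixed, σ can move an entry of row r only downwards
in its column, where the value is strictly larger. The row sum is unchanged by τ, so nothing in row
r moves. -/
theorem eq_one_of_rows_rearranged {σ τ : Equiv.Perm (Fin n)} (hσ : σ ∈ T.colGroup)
    (hτ : ∀ i, (T.box (τ i)).1 = (T.box i).1)
    (h : ∀ i, finiteExponent M T (σ i) = finiteExponent M T (τ.symm i)) : σ = 1 := by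
  have key : ∀ r, ∀ k, (T.box k).1 = r → σ k = k := by
    intro r
    induction r using Nat.strong_induction_on with
    | _ r ih =>
      have hge : ∀ k, (T.box k).1 = r → r ≤ (T.box (σ k)).1 := fun k hk => by
        by_contra hlt
        have h1 := σ.injective (ih _ (not_le.mp hlt) (σ k) rfl)
        rw [h1] at hlt
        omega
      have hlt : ∀ k, (T.box k).1 = r → σ k ≠ k →
          finiteExponent M T k < finiteExponent M T (σ k) := fun k hk hne => by
        rw [finiteExponent_apply, finiteExponent_apply, hσ k]
        refine M.col_strict (lt_of_le_of_ne (hk ▸ hge k hk) fun he => hne ?_) ?_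
        · exact T.box_injective (Prod.ext he.symm (hσ k))
        · rw [← hσ k]
          exact T.box_mem (σ k)
      set s := Finset.univ.filter (fun k => (T.box k).1 = r) with hs
      have hmem : ∀ {k}, k ∈ s ↔ (T.box k).1 = r := by simp [hs]
      have hle : ∀ k ∈ s, finiteExponent M T k ≤ finiteExponent M T (σ k) := fun k hk => by
        by_cases hne : σ k = k
        · rw [hne]
        · exact (hlt k (hmem.mp hk) hne).le
      have hsum : ∑ k ∈ s, finiteExponent M T k = ∑ k ∈ s, finiteExponent M T (σ k) := by
        rw [Finset.sum_congr rfl fun k _ => h k]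
        refine Finset.sum_equiv τ (fun k => ?_) fun k _ => by rw [Equiv.symm_apply_apply]
        rw [hmem, hmem, hτ]
      intro k hk
      by_contra hne
      exact (hlt k hk hne).ne ((Finset.sum_eq_sum_iff_of_le hle).mp hsum k (hmem.mpr hk))
  ext k
  rw [key _ k rfl]
  rfl

/-- By the triangularity above, only σ = 1 contributes to this coefficient. -/
theorem coeff_finiteExponent_spechtPoly :
    MvPolynomial.coeff (finiteExponent M T) (spechtPoly M T) = 1 := by
  classical
  rw [coeff_spechtPoly, Finset.sum_eq_single 1]
  · rw [if_pos ⟨1, fun _ => rfl, by ext; rfl⟩]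
    simp
  · intro σ hσ hne
    rw [if_neg, mul_zero]
    rintro ⟨τ, hτ, h⟩
    refine hne (eq_one_of_rows_rearranged M T (by simpa using hσ) hτ fun i => ?_)
    exact DFunLike.congr_fun h i
  · intro h
    exact absurd (Finset.mem_filter.mpr ⟨Finset.mem_univ _, one_mem _⟩) h

theorem spechtPoly_ne_zero : spechtPoly M T ≠ 0 := fun h => by
  have := coeff_finiteExponent_spechtPoly M T
  rw [h, MvPolynomial.coeff_zero] at this
  exact zero_ne_one this

theorem MvPolynomial.esymm_ne_zero_of_le {r : ℕ} (hr : r ≤ n) :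
    MvPolynomial.esymm (Fin n) ℚ r ≠ 0 := fun h => by
  -- At the point (1, …, 1) the value is the binomial coefficient of n over r.
  have h1 := congrArg (MvPolynomial.eval (fun _ => (1 : ℚ))) h
  simp only [MvPolynomial.esymm, map_sum, map_prod, MvPolynomial.eval_X, Finset.prod_const_one,
    Finset.sum_const, Finset.card_powersetCard, Finset.card_univ, Fintype.card_fin, map_zero,
    nsmul_eq_mul, mul_one, Nat.cast_eq_zero] at h1
  exact (Nat.choose_pos hr).ne' h1

theorem MvPolynomial.prod_esymm_ne_zero (s : Multiset ℕ) (g : ℕ → ℕ) (h : ∀ i ∈ s, g i ≤ n) :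
    (s.map (fun i => MvPolynomial.esymm (Fin n) ℚ (g i))).prod ≠ 0 := by
  refine Multiset.prod_ne_zero ?_
  rw [Multiset.mem_map]
  rintro ⟨i, hi, h0⟩
  exact MvPolynomial.esymm_ne_zero_of_le (h i hi) h0

theorem spechtPolyHom_ne_zero {I : Multiset ℕ} (hI : ∀ i ∈ I, i ≤ n) :
    spechtPolyHom M T I ≠ 0 :=
  mul_ne_zero (spechtPoly_ne_zero M T) (MvPolynomial.prod_esymm_ne_zero _ _ fun i hi =>
    hI i (Multiset.mem_of_le tsub_le_self hi))

theorem finiteR_le (I : Finset ℕ) (i : ℕ) : finiteR n I i ≤ n :=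
  calc finiteR n I i ≤ (Finset.Ico 1 n).card :=
        Finset.card_le_card ((Finset.filter_subset _ _).trans Finset.sdiff_subset)
    _ ≤ n := by rw [Nat.card_Ico]; exact Nat.sub_le _ _

theorem spechtPolySet_ne_zero (I : Finset ℕ) : spechtPolySet M T I ≠ 0 :=
  mul_ne_zero (spechtPoly_ne_zero M T) (MvPolynomial.prod_esymm_ne_zero _ _ fun i _ =>
    finiteR_le I i)

end

/-! ### Uniqueness of extensions -/

section

variable {L : InfiniteFerrers} {That : StdTableau ℕ L.cells} {D : MvPowerSeries ℕ ℚ}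

theorem TransformsBySgnTilde.permAct_eq (hD : TransformsBySgnTilde That D) {v : Equiv.Perm ℕ}
    (hv : v ∈ That.rowGroup ⊓ That.colTildeGroup) : permAct v D = D := by
  have h := sgnTilde_mul That (one_mem _) hv
  rw [one_mul, finitarySign_one] at h
  rw [hD v hv.2, h]
  simp

/-- The transposition of a and b fixes the monomial but acts by -1, so the coefficient equals its
own negative. -/
theorem TransformsBySgnTilde.coeff_eq_zero (hD : TransformsBySgnTilde That D) {a b : ℕ}
    (hab : a ≠ b) (hcol : (That.box a).2 = (That.box b).2) {m : ℕ →₀ ℕ} (hm : m a = m b) :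
    MvPowerSeries.coeff m D = 0 := by
  have hc := That.swap_mem_colGroup hcol
  have h1 := sgnTilde_mul That hc (one_mem _)
  rw [mul_one, finitarySign_swap hab] at h1
  have h2 := congrArg (MvPowerSeries.coeff m) (hD _ (That.colGroup_le_colTildeGroup hc))
  rw [h1, coeff_permAct, map_smul] at h2
  have h3 : m.equivMapDomain (Equiv.swap a b)⁻¹ = m := by
    ext i
    change m (Equiv.swap a b i) = m i
    rw [Equiv.swap_apply_def]
    split_ifs with ha hb
    · rw [ha, hm]
    · rw [hb, hm]
    · rfl
  rw [h3] at h2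
  simp only [Units.val_neg, Units.val_one, Int.cast_neg, Int.cast_one, smul_eq_mul] at h2
  linarith

theorem TransformsBySgnTilde.sub {G : MvPowerSeries ℕ ℚ} (hD : TransformsBySgnTilde That D)
    (hG : TransformsBySgnTilde That G) : TransformsBySgnTilde That (D - G) := fun σ hσ => by
  rw [permAct_sub, hD σ hσ, hG σ hσ, smul_sub]

variable {n : ℕ} {lam : YoungDiagram} {T : StdTableau (Fin n) (lam : Set (ℕ × ℕ))}
  {M : SemistandardYoungTableau lam} {Mhat : InfiniteSSYT L}

theorem coeff_eq_zero_of_support_subset (hres : restrictVars n D = 0) {m : ℕ →₀ ℕ}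
    (hm : ∀ i ∈ m.support, i < n) : MvPowerSeries.coeff m D = 0 := by
  have h : m ∈ Set.range (Finsupp.embDomain (Fin.valEmbedding : Fin n ↪ ℕ)) := by
    rw [Finsupp.mem_range_embDomain_iff]
    exact fun i hi => ⟨⟨i, hm i hi⟩, rfl⟩
  obtain ⟨q, rfl⟩ := h
  rw [← coeff_restrictVars, hres, map_zero]

/-- If the support of a monomial is small, and its exponents in each column are distinct, then
the first `n` entries in columns with a single box are not all in the support, unless the support
is contained in the first `n` entries. -/
theorem exists_notMem_support {m : ℕ →₀ ℕ} {w : ℕ}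
    (hinj : ∀ a b, a ≠ b → (That.box a).2 = (That.box b).2 → m a ≠ m b)
    (hcard : m.support.card + w ≤ n) {a : ℕ} (ha : a ∈ m.support) (han : n ≤ a) :
    ∃ y < n, w ≤ (That.box y).2 ∧ y ∉ m.support := by
  by_contra! hcon
  set A := (Finset.range n).filter (fun i => w ≤ (That.box i).2) with hA
  set B := (Finset.range n).filter (fun i => ¬ w ≤ (That.box i).2) with hB
  have h1 : A.card + B.card = n := by
    rw [hA, hB, Finset.card_filter_add_card_filter_not, Finset.card_range]
  -- Each of the first w columns has at most one entry with exponent zero.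
  have h2 : (B.filter (· ∉ m.support)).card ≤ w := by
    rw [← Finset.card_range w]
    refine Finset.card_le_card_of_injOn (fun i => (That.box i).2) (fun i hi => ?_) ?_
    · have := (Finset.mem_filter.mp (Finset.mem_filter.mp hi).1).2
      exact Finset.mem_coe.mpr (Finset.mem_range.mpr (not_le.mp this))
    · intro i hi j hj hij
      by_contra hne
      have hi' := Finsupp.notMem_support_iff.mp (Finset.mem_filter.mp hi).2
      have hj' := Finsupp.notMem_support_iff.mp (Finset.mem_filter.mp hj).2
      exact hinj i j hne hij (hi'.trans hj'.symm)
  have h3 := Finset.card_filter_add_card_filter_not (s := B) (· ∈ m.support)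
  have hAB : Disjoint A (B.filter (· ∈ m.support)) :=
    (Finset.disjoint_filter_filter_not _ _ _).mono_right (Finset.filter_subset _ _)
  -- If all of A were used, the support would have at least 1 + |A| + (|B| - w) = n + 1 - w
  -- elements, one too many.
  have h4 : (insert a (A ∪ B.filter (· ∈ m.support))).card ≤ m.support.card := by
    refine Finset.card_le_card fun i hi => ?_
    rw [Finset.mem_insert, Finset.mem_union] at hi
    rcases hi with rfl | hi | hi
    · exact ha
    · obtain ⟨h5, h6⟩ := Finset.mem_filter.mp hi
      exact hcon i (Finset.mem_range.mp h5) h6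
    · exact (Finset.mem_filter.mp hi).2
  have hnot : a ∉ A ∪ B.filter (· ∈ m.support) := fun hc => by
    have : a ∈ Finset.range n := by
      rcases Finset.mem_union.mp hc with h | h
      · exact (Finset.mem_filter.mp h).1
      · exact (Finset.mem_filter.mp (Finset.mem_filter.mp h).1).1
    exact absurd (Finset.mem_range.mp this) (not_lt.mpr han)
  rw [Finset.card_insert_of_notMem hnot, Finset.card_union_of_disjoint hAB] at h4
  omega

/-- Induction on the number of variables with index ≥ n. Such an index a is exchanged with an unused
y < n whose column also lies beyond λ₂; the exchange is in `rowGroup ⊓ colTildeGroup`, so it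
preserves the coefficient. -/
theorem eq_zero_of_restrictVars_eq_zero (hT : TableauProduces T That) (hM : SSYTProduces M Mhat)
    (hD : TransformsBySgnTilde That D) (hres : restrictVars n D = 0)
    (hcard : ∀ m, MvPowerSeries.coeff m D ≠ 0 → m.support.card + lam.rowLen 1 ≤ n) : D = 0 := by
  have key : ∀ (N : ℕ) (m : ℕ →₀ ℕ), (m.support.filter (n ≤ ·)).card = N →
      MvPowerSeries.coeff m D = 0 := by
    intro N
    induction N with
    | zero =>
      intro m hm
      refine coeff_eq_zero_of_support_subset hres fun i hi => ?_
      by_contra hc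
      have := Finset.card_eq_zero.mp hm
      exact absurd (Finset.mem_filter.mpr ⟨hi, not_lt.mp hc⟩) (this ▸ Finset.notMem_empty i)
    | succ N ih =>
      intro m hm
      by_contra hne
      obtain ⟨a, ha⟩ := Finset.card_pos.mp (by omega : 0 < (m.support.filter (n ≤ ·)).card)
      obtain ⟨ha, han⟩ := Finset.mem_filter.mp ha
      obtain ⟨y, hyn, hyw, hy⟩ := exists_notMem_support (That := That) (w := lam.rowLen 1)
        (fun a b hab hcol hmab => hne (hD.coeff_eq_zero hab hcol hmab)) (hcard m hne) ha han
      have haw : lam.rowLen 1 ≤ (That.box a).2 := by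
        rw [hT.box_of_le han]
        exact (lam.rowLen_anti 0 1 zero_le_one).trans (Nat.le_add_right _ _)
      have hv : Equiv.swap a y ∈ That.rowGroup ⊓ That.colTildeGroup := by
        refine That.mem_rowGroup_inf_colTildeGroup fun i hi c hc hci => ?_
        refine hM.single_column That ?_ hc hci
        rcases (Equiv.swap_apply_ne_self_iff.mp hi).2 with rfl | rfl
        · exact haw
        · exact hyw
      have h1 := coeff_equivMapDomain_permAct (Equiv.swap a y) D m
      rw [hD.permAct_eq hv] at h1
      refine hne (h1.symm.trans (ih _ ?_))
      have h2 : (m.equivMapDomain (Equiv.swap a y)).support.filter (n ≤ ·) =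
          (m.support.filter (n ≤ ·)).erase a := by
        ext i
        rw [Finset.mem_filter, Finset.mem_erase, Finset.mem_filter, Finsupp.mem_support_iff,
          Finsupp.equivMapDomain_apply, Equiv.symm_swap, Finsupp.mem_support_iff]
        by_cases hia : i = a
        · subst hia
          rw [Equiv.swap_apply_left]
          simp [Finsupp.notMem_support_iff.mp hy]
        · by_cases hiy : i = y
          · subst hiy
            simp [not_le.mpr hyn]
          · rw [Equiv.swap_apply_of_ne_of_ne hia hiy]
            simp [hia]
      rw [h2, Finset.card_erase_of_mem (Finset.mem_filter.mpr ⟨ha, han⟩), hm, Nat.succ_sub_one]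
  ext m
  rw [key _ m rfl, map_zero]

theorem card_support_le_degree (m : ℕ →₀ ℕ) : m.support.card ≤ m.degree := by
  rw [Finset.card_eq_sum_ones]
  exact Finset.sum_le_sum fun i hi => Nat.one_le_iff_ne_zero.mpr (Finsupp.mem_support_iff.mp hi)

theorem eq_of_restrictVars_eq_of_evSymDeg (hT : TableauProduces T That)
    (hM : SSYTProduces M Mhat) {d e : ℕ} {F G : MvPowerSeries ℕ ℚ}
    {P : MvPolynomial (Fin n) ℚ} (hP : P ≠ 0) (hF : F ∈ evSymDeg d)
    (hFt : TransformsBySgnTilde That F) (hFr : restrictVars n F = P) (hG : G ∈ evSymDeg e)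
    (hGt : TransformsBySgnTilde That G) (hGr : restrictVars n G = P)
    (hd : d + lam.rowLen 1 ≤ n) : G = F := by
  obtain ⟨q, hq⟩ := MvPolynomial.ne_zero_iff.mp hP
  have hqF := coeff_restrictVars q F
  have hqG := coeff_restrictVars q G
  rw [hFr, MvPolynomial.coeff_coe] at hqF
  rw [hGr, MvPolynomial.coeff_coe] at hqG
  -- A monomial q of P occurs in both F and G, which forces their degrees to agree.
  have hde : e = d := (hG.2 _ (hqG ▸ hq)).symm.trans (hF.2 _ (hqF ▸ hq))
  subst hde
  refine sub_eq_zero.mp (eq_zero_of_restrictVars_eq_zero hT hM (hGt.sub hFt) ?_ fun m hm => ?_)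
  · rw [restrictVars_sub, hFr, hGr, sub_self]
  · have hdeg : m.degree = e := by
      by_contra hc
      refine hm ?_
      rw [map_sub, not_imp_comm.mp (hG.2 m) hc, not_imp_comm.mp (hF.2 m) hc, sub_zero]
    have := card_support_le_degree m
    omega

theorem StdTableau.card_cells (T : StdTableau (Fin n) (lam : Set (ℕ × ℕ))) :
    lam.cells.card = n := by
  have h : lam.cells = Finset.univ.image T.box := by
    ext c
    rw [Finset.mem_image]
    constructor
    · intro hc
      obtain ⟨i, hi⟩ := T.exists_box_eq (c := c) hc
      exact ⟨i, Finset.mem_univ i, hi⟩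
    · rintro ⟨i, -, rfl⟩
      exact T.box_mem i
  rw [h, Finset.card_image_of_injective _ T.box_injective, Finset.card_univ, Fintype.card_fin]

/-- Of the n boxes, those with positive entries make up the content, and the λ₂ first-row boxes
lying over another box contain zeros. -/
theorem SSYTProduces.card_content_add_rowLen_le (hM : SSYTProduces M Mhat)
    (T : StdTableau (Fin n) (lam : Set (ℕ × ℕ))) (h0 : ∀ j, (1, j) ∈ lam → M 0 j = 0) :
    Multiset.card Mhat.content + lam.rowLen 1 ≤ n := by
  have h1 : Multiset.card Mhat.content =
      (lam.cells.filter (fun c => 0 < M c.1 c.2)).card := by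
    rw [← hM.filter_pos_content, SemistandardYoungTableau.content, Multiset.filter_map,
      Multiset.card_map]
    rfl
  have h2 : lam.rowLen 1 ≤ (lam.cells.filter (fun c => ¬ 0 < M c.1 c.2)).card := by
    rw [← Finset.card_range (lam.rowLen 1)]
    refine Finset.card_le_card_of_injOn (fun j => (0, j)) (fun j hj => ?_)
      fun a _ b _ hab => (Prod.ext_iff.mp hab).2
    have hj1 : (1, j) ∈ lam :=
      YoungDiagram.mem_iff_lt_rowLen.mpr (Finset.mem_range.mp (Finset.mem_coe.mp hj))
    have hj0 : (0, j) ∈ lam := lam.isLowerSet (Prod.mk_le_mk.mpr ⟨zero_le_one, le_rfl⟩) hj1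
    simp [hj0, h0 j hj1]
  have h3 := Finset.card_filter_add_card_filter_not (s := lam.cells)
    (fun c : ℕ × ℕ => 0 < M c.1 c.2)
  rw [T.card_cells] at h3
  omega

/-- The prescribed content fixes the number of variables of every monomial in the difference, so no
degree bound is needed. -/
theorem eq_stableSpecht_of_evSymContent (hT : TableauProduces T That) (hM : SSYTProduces M Mhat)
    (h0 : ∀ j, (1, j) ∈ lam → M 0 j = 0) {G : MvPowerSeries ℕ ℚ}
    (hG : G ∈ evSymContent Mhat.content) (hGt : TransformsBySgnTilde That G)
    (hGr : restrictVars n G = (spechtPoly M T : MvPowerSeries (Fin n) ℚ)) :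
    G = stableSpecht Mhat That := by
  refine sub_eq_zero.mp (eq_zero_of_restrictVars_eq_zero hT hM
    (hGt.sub (transformsBySgnTilde_stableSpecht Mhat That)) ?_ fun m hm => ?_)
  · rw [restrictVars_sub, hGr, restrictVars_stableSpecht hT hM, sub_self]
  · have hc := ((evSymContentSubmodule Mhat.content).sub_mem hG
      (stableSpecht_mem_evSymContent Mhat That)).2 m hm
    rw [← card_monomialContent, hc]
    exact hM.card_content_add_rowLen_le T h0

end

theorem proposition2p11 (L : InfiniteFerrers) (That : StdTableau ℕ L.cells)
    (Mhat : InfiniteSSYT L) :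
    -- equivariance
    TransformsBySgnTilde That (stableSpecht Mhat That) ∧
    -- content and degree
    (stableSpecht Mhat That ∈ evSymContent Mhat.content ∧
      stableSpecht Mhat That ∈ evSymDeg Mhat.content.sum ∧
      (stableSpechtSpace Mhat : Set (MvPowerSeries ℕ ℚ)) ⊆ evSymContent Mhat.content ∧
      evSymContent Mhat.content ⊆ evSymDeg Mhat.content.sum ∧
      evSymDeg Mhat.content.sum ⊆ evSym) ∧
    -- the products with elementary symmetric functions
    (Mhat.IsCocharge →
      (∀ I : Finset ℕ, 0 ∉ I → dspc Mhat.content ≤ I.val →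
        stableSpechtSet Mhat That I ∈ evSymDeg (stableSetDegree Mhat I)) ∧
      (∀ I : Multiset ℕ, dspc Mhat.content ≤ I →
        stableSpechtHom Mhat That I ∈ evSymDeg I.sum) ∧
      (∀ h : ℕ →₀ ℕ, stableSpechtSpaceMul Mhat h ⊆
        evSymDeg (Mhat.content.sum + h.sum (fun r k => k * r)))) ∧
    -- the relation with the finite objects
    (∀ (n : ℕ) (lam : YoungDiagram) (T : StdTableau (Fin n) (lam : Set (ℕ × ℕ)))
        (M : SemistandardYoungTableau lam),
      TableauProduces T That → SSYTProduces M Mhat →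
      -- the specialization of `F_{M̂,T̂}`
      restrictVars n (stableSpecht Mhat That) = (spechtPoly M T : MvPowerSeries (Fin n) ℚ) ∧
      -- uniqueness with the given content, if the first row of `M` is zero above other boxes
      ((∀ j, (1, j) ∈ lam → M 0 j = 0) →
        ∀ G ∈ evSymContent Mhat.content, TransformsBySgnTilde That G →
          restrictVars n G = (spechtPoly M T : MvPowerSeries (Fin n) ℚ) →
          G = stableSpecht Mhat That) ∧
      -- uniqueness among all homogeneous elements, for large `n`
      (Mhat.content.sum + lam.rowLen 1 ≤ n →
        ∀ e : ℕ, ∀ G ∈ evSymDeg e, TransformsBySgnTilde That G →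
          restrictVars n G = (spechtPoly M T : MvPowerSeries (Fin n) ℚ) →
          G = stableSpecht Mhat That) ∧
      -- the homogeneous products, for multi-sets `I`
      (Mhat.IsCocharge → ∀ I : Multiset ℕ, dspc Mhat.content ≤ I →
        (∀ i ∈ I, i ≤ n) →
        TransformsBySgnTilde That (stableSpechtHom Mhat That I) ∧
        restrictVars n (stableSpechtHom Mhat That I) =
          (spechtPolyHom M T I : MvPowerSeries (Fin n) ℚ) ∧
        (I.sum + lam.rowLen 1 ≤ n →
          ∀ e : ℕ, ∀ G ∈ evSymDeg e, TransformsBySgnTilde That G →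
            restrictVars n G = (spechtPolyHom M T I : MvPowerSeries (Fin n) ℚ) →
            G = stableSpechtHom Mhat That I)) ∧
      -- the other products, for sets `I`
      (Mhat.IsCocharge → ∀ I : Finset ℕ, dspc Mhat.content ≤ I.val →
        (∀ i ∈ I, 0 < i ∧ i < n) →
        TransformsBySgnTilde That (stableSpechtSet Mhat That I) ∧
        restrictVars n (stableSpechtSet Mhat That I) =
          (spechtPolySet M T I : MvPowerSeries (Fin n) ℚ) ∧
        (stableSetDegree Mhat I + lam.rowLen 1 ≤ n →
          ∀ e : ℕ, ∀ G ∈ evSymDeg e, TransformsBySgnTilde That G →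
            restrictVars n G = (spechtPolySet M T I : MvPowerSeries (Fin n) ℚ) →
            G = stableSpechtSet Mhat That I))) := by
  refine ⟨transformsBySgnTilde_stableSpecht Mhat That,
    ⟨stableSpecht_mem_evSymContent Mhat That, stableSpecht_mem_evSymDeg Mhat That,
      stableSpechtSpace_le Mhat, evSymContent_subset_evSymDeg _, fun F hF => hF.1⟩,
    fun _ => ⟨fun I _ _ => stableSpechtSet_mem_evSymDeg Mhat That I,
      fun I hI => stableSpechtHom_mem_evSymDeg Mhat That hI,
      stableSpechtSpaceMul_subset Mhat⟩, ?_⟩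
  intro n lam T M hT hM
  refine ⟨restrictVars_stableSpecht hT hM,
    fun h0 G hG hGt hGr => eq_stableSpecht_of_evSymContent hT hM h0 hG hGt hGr,
    fun hd e G hG hGt hGr => eq_of_restrictVars_eq_of_evSymDeg hT hM (spechtPoly_ne_zero M T)
      (stableSpecht_mem_evSymDeg Mhat That) (transformsBySgnTilde_stableSpecht Mhat That)
      (restrictVars_stableSpecht hT hM) hG hGt hGr hd,
    fun _ I hI hIn => ?_, fun _ I _ hIn => ?_⟩
  · have ht := transformsBySgnTilde_stableSpechtHom Mhat That I
    have hr := restrictVars_stableSpechtHom hT hM I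
    exact ⟨ht, hr, fun hd e G hG hGt hGr => eq_of_restrictVars_eq_of_evSymDeg hT hM
      (spechtPolyHom_ne_zero M T hIn) (stableSpechtHom_mem_evSymDeg Mhat That hI) ht hr
      hG hGt hGr hd⟩
  · have ht := transformsBySgnTilde_stableSpechtSet Mhat That I
    have hr := restrictVars_stableSpechtSet hT hM (I := I) fun i hi => (hIn i hi).2.le
    exact ⟨ht, hr, fun hd e G hG hGt hGr => eq_of_restrictVars_eq_of_evSymDeg hT hM
      (spechtPolySet_ne_zero M T I) (stableSpechtSet_mem_evSymDeg Mhat That I) ht hr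
      hG hGt hGr hd⟩
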